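/- Let $\mathcal{G}$ be a (discrete) groupoid with unit space $\mathcal{G}^{(0)}$, source map $d$ and range map $r$, and write $\mathcal{G}_u^v=\{g\in\mathcal{G}: d(g)=u,\ r(g)=v\}$. A (compact) $\mathcal{G}$-space is a family $\mathcal{X}=\{X_u\}_{u\in\mathcal{G}^{(0)}}$ of nonempty compact Hausdorff spaces with homeomorphisms $X_{d(g)}\to X_{r(g)}$, $x\mapsto g\cdot x$ $(g\in\mathcal{G})$, such that units act as identities and $g\cdot(h\cdot x)=(gh)\cdot x$ for composable $g,h$. It is minimal if the only family of nonempty closed sets $Y_u\subseteq X_u$ with $g\cdot Y_{d(g)}=Y_{r(g)}$ for all $g$ is $Y_u=X_u$. It is strongly proximal if, whenever $\mathcal{G}_u^v\neq\emptyset$ and $\mu$ is a Radon probability measure on $X_u$, the weak$^*$-closure of $\{g\cdot\mu: g\in\mathcal{G}_u^v\}$ contains a point mass $\delta_x$, $x\in X_v$. A $\mathcal{G}$-boundary is a minimal and strongly proximal compact $\mathcal{G}$-space. A Furstenberg boundary $\partial_F\mathcal{G}$ is a $\mathcal{G}$-boundary such that for every $\mathcal{G}$-boundary $\mathcal{Z}$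 there is an equivariant family of continuous surjections $\partial_F\mathcal{G}\to\mathcal{Z}$. Two $\mathcal{G}$-spaces are $\mathcal{G}$-isomorphic if there is an equivariant family of homeomorphisms between their fibres. A groupoid dynamical system $\mathcal{A}$ is a family $\{A_u\}_{u\in\mathcal{G}^{(0)}}$ of operator systems (closed self-adjoint subspaces, containing the unit, of unital $C^*$-algebras) with unital complete order isomorphisms $\alpha_g:A_{d(g)}\to A_{r(g)}$ such that $\alpha_g\alpha_h=\alpha_{gh}$ for composable $g,h$. A $\mathcal{G}$-morphism is an equivariant family of unital completely positive maps; it is a $\mathcal{G}$-embedding if each of its components is a complete order embedding. A system $\mathcal{W}$ is $\mathcal{G}$-injective if for every $\mathcal{G}$-embedding $\Phi:\mathcal{A}\to\mathcal{B}$ and every $\mathcal{G}$-morphism $\Psi:\mathcal{A}\to\mathcal{W}$ there is a $\mathcal{G}$-morphism $\Theta:\mathcal{B}\to\mathcal{W}$ with $\Theta\circ\Phi=\Psi$. A $\mathcal{G}$-injective envelope of $\mathcal{A}$ is a $\mathcal{G}$-embedding $\Theta:\mathcal{A}\to\mathcal{W}$ into a $\mathcal{G}$-injective system that is rigid: a $\mathcal{G}$-morphism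 $\Phi:\mathcal{W}\to\mathcal{W}$ with $\Phi\circ\Theta=\Theta$ is the identity. A compact $\mathcal{G}$-space $\{X_u\}$ is a Hamana boundary $\partial_H\mathcal{G}$ if the system $\{C(X_u)\}_u$, with the action $(g\cdot f)(x)=f(g^{-1}\cdot x)$ and the embedding of scalars as constant functions, is a $\mathcal{G}$-injective envelope of the trivial system $\{\mathbb{C}\}_u$ (on which every $g$ acts as the identity). Theorem. For every groupoid $\mathcal{G}$, a Furstenberg boundary $\partial_F\mathcal{G}$ and a Hamana boundary $\partial_H\mathcal{G}$ exist, and every Furstenberg boundary of $\mathcal{G}$ is $\mathcal{G}$-isomorphic to every Hamana boundary of $\mathcal{G}$. -/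

import Mathlib

open CategoryTheory MeasureTheory
open scoped Matrix

universe w v u

noncomputable section

/-! ## Operator systems -/

/-- An operator system: a closed self-adjoint linear subspace of a unital C*-algebra that
contains the unit of the algebra. -/
structure OperatorSystem where
  Ambient : Type w
  [cstar : CStarAlgebra Ambient]
  carrier : Submodule ℂ Ambient
  isClosed : IsClosed (carrier : Set Ambient)
  star_mem : ∀ a ∈ carrier, star a ∈ carrier
  one_mem : (1 : Ambient) ∈ carrier

namespace OperatorSystem

attribute [instance] OperatorSystem.cstar

/-- The elements of an operator system. -/
abbrev Elt (S : OperatorSystem.{w}) : Type w := S.carrier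

/-- The unit of an operator system. -/
def unit (S : OperatorSystem.{w}) : S.Elt := ⟨1, S.one_mem⟩

/-- A matrix over an operator system is positive if it is a positive element `N* N` of the
C*-algebra of matrices over the ambient C*-algebra. -/
def MatrixPositive (S : OperatorSystem.{w}) {n : ℕ} (M : Matrix (Fin n) (Fin n) S.Elt) : Prop :=
  ∃ N : Matrix (Fin n) (Fin n) S.Ambient, M.map (fun a => (a : S.Ambient)) = Nᴴ * N

/-- Unital completely positive maps. -/
def IsUCP {S T : OperatorSystem.{w}} (φ : S.Elt →ₗ[ℂ] T.Elt) : Prop :=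
  φ S.unit = T.unit ∧
    ∀ (n : ℕ) (M : Matrix (Fin n) (Fin n) S.Elt), S.MatrixPositive M → T.MatrixPositive (M.map φ)

/-- Unital complete order embeddings. -/
def IsCompleteOrderEmbedding {S T : OperatorSystem.{w}} (φ : S.Elt →ₗ[ℂ] T.Elt) : Prop :=
  φ S.unit = T.unit ∧
    ∀ (n : ℕ) (M : Matrix (Fin n) (Fin n) S.Elt), S.MatrixPositive M ↔ T.MatrixPositive (M.map φ)

/-- Unital complete order isomorphisms. -/
def IsCompleteOrderIso {S T : OperatorSystem.{w}} (φ : S.Elt →ₗ[ℂ] T.Elt) : Prop :=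
  Function.Bijective φ ∧ IsCompleteOrderEmbedding φ

/-- A unital C*-algebra, as an operator system. -/
abbrev ofCStarAlgebra (A : Type w) [CStarAlgebra A] : OperatorSystem.{w} where
  Ambient := A
  carrier := ⊤
  isClosed := isClosed_univ
  star_mem := fun _ _ => Submodule.mem_top
  one_mem := Submodule.mem_top

/-- A *-isomorphism of unital C*-algebras, as a linear map of operator systems. -/
def mapOfStarAlgEquiv {A B : Type w} [CStarAlgebra A] [CStarAlgebra B] (e : A ≃⋆ₐ[ℂ] B) :
    (ofCStarAlgebra A).Elt →ₗ[ℂ] (ofCStarAlgebra B).Elt where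
  toFun a := ⟨e a.1, Submodule.mem_top⟩
  map_add' a b := Subtype.ext (map_add e a.1 b.1)
  map_smul' c a := Subtype.ext (map_smul e c a.1)

theorem isCompleteOrderIso_mapOfStarAlgEquiv {A B : Type w} [CStarAlgebra A] [CStarAlgebra B]
    (e : A ≃⋆ₐ[ℂ] B) : IsCompleteOrderIso (mapOfStarAlgEquiv e) := by
  have key : ∀ {C D : Type w} [CStarAlgebra C] [CStarAlgebra D] (f : C ≃⋆ₐ[ℂ] D) (n : ℕ)
      (N : Matrix (Fin n) (Fin n) C), (Nᴴ * N).map f = (N.map f)ᴴ * N.map f := by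
    intro C D _ _ f n N
    ext i j
    simp [Matrix.mul_apply, map_sum, map_star]
  refine ⟨⟨fun a b h => ?_, fun b => ?_⟩, Subtype.ext (map_one e), fun n M => ⟨?_, ?_⟩⟩
  · exact Subtype.ext (e.injective (congrArg Subtype.val h))
  · exact ⟨⟨e.symm b.1, Submodule.mem_top⟩, Subtype.ext (e.apply_symm_apply b.1)⟩
  · rintro ⟨N, hN⟩
    refine ⟨N.map e, ?_⟩
    refine Eq.trans ?_ (key e n N)
    refine Eq.trans ?_ (congrArg (fun P : Matrix (Fin n) (Fin n) A => P.map e) hN)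
    rfl
  · rintro ⟨N, hN⟩
    refine ⟨N.map e.symm, ?_⟩
    refine Eq.trans ?_ (key e.symm n N)
    refine Eq.trans ?_ (congrArg (fun P : Matrix (Fin n) (Fin n) B => P.map e.symm) hN)
    ext i j
    exact (e.symm_apply_apply (M i j).1).symm

end OperatorSystem

/-! ## Groupoid dynamical systems

A groupoid is a (small) groupoid category: the objects are the units, and a groupoid element `g`
with source `d(g) = x` and range `r(g) = y` is an arrow `g : x ⟶ y`. The product `g h` of the
groupoid is the composite `h ≫ g`. -/

/-- A groupoid dynamical system: operator systems indexed by the units, and complete order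
isomorphisms `act g : A_{d(g)} → A_{r(g)}` with `act (g h) = act g ∘ act h`. -/
structure GSystem (𝒢 : Type u) [Groupoid.{v} 𝒢] where
  fibre : 𝒢 → OperatorSystem.{w}
  act : ∀ {x y : 𝒢}, (x ⟶ y) → ((fibre x).Elt →ₗ[ℂ] (fibre y).Elt)
  act_iso : ∀ {x y : 𝒢} (g : x ⟶ y), OperatorSystem.IsCompleteOrderIso (act g)
  act_mul : ∀ {x y z : 𝒢} (h : x ⟶ y) (g : y ⟶ z) (a : (fibre x).Elt),
    act (h ≫ g) a = act g (act h a)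

variable {𝒢 : Type u} [Groupoid.{v} 𝒢]

/-- Morphisms of groupoid dynamical systems: equivariant families of unital completely positive
maps. -/
structure GMorphism (A B : GSystem.{w, v, u} 𝒢) where
  map : ∀ x : 𝒢, (A.fibre x).Elt →ₗ[ℂ] (B.fibre x).Elt
  ucp : ∀ x, OperatorSystem.IsUCP (map x)
  equivariant : ∀ {x y : 𝒢} (g : x ⟶ y) (a : (A.fibre x).Elt),
    B.act g (map x a) = map y (A.act g a)

/-- A morphism is an embedding if each of its components is a complete order embedding. -/
def GMorphism.IsEmbedding {A B : GSystem.{w, v, u} 𝒢} (Φ : GMorphism A B) : Prop :=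
  ∀ x, OperatorSystem.IsCompleteOrderEmbedding (Φ.map x)

/-- Injective groupoid dynamical systems: morphisms into `W` extend along embeddings. -/
def GSystem.IsInjective (W : GSystem.{w, v, u} 𝒢) : Prop :=
  ∀ (A B : GSystem.{w, v, u} 𝒢) (Φ : GMorphism A B) (Ψ : GMorphism A W), Φ.IsEmbedding →
    ∃ Θ : GMorphism B W, ∀ x a, Θ.map x (Φ.map x a) = Ψ.map x a

/-- An extension `Θ : A → W` is rigid if the identity is the only endomorphism of `W` that fixes
the image of `A` pointwise. -/
def GMorphism.IsRigid {A W : GSystem.{w, v, u} 𝒢} (Θ : GMorphism A W) : Prop :=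
  ∀ Φ : GMorphism W W, (∀ x a, Φ.map x (Θ.map x a) = Θ.map x a) → ∀ x b, Φ.map x b = b

/-- `(W, Θ)` is an injective envelope of `A`: it is an extension of `A` that is injective and
rigid. -/
def GMorphism.IsInjectiveEnvelope {A W : GSystem.{w, v, u} 𝒢} (Θ : GMorphism A W) : Prop :=
  Θ.IsEmbedding ∧ W.IsInjective ∧ Θ.IsRigid

/-! ### The trivial system -/

/-- The C*-algebra `ℂ`, placed in an arbitrary universe. -/
instance instCStarAlgebraULiftComplex : CStarAlgebra (ULift.{w} ℂ) where
  star z := ⟨star z.down⟩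
  star_involutive z := congrArg ULift.up (star_star z.down)
  star_mul a b := congrArg ULift.up (star_mul a.down b.down)
  star_add a b := congrArg ULift.up (star_add a.down b.down)
  norm_mul_self_le z := CStarRing.norm_mul_self_le z.down
  star_smul c z := congrArg ULift.up (star_smul c z.down)

/-- The trivial system: all fibres are `ℂ`, and all groupoid elements act as the identity. -/
def trivialSystem (𝒢 : Type u) [Groupoid.{v} 𝒢] : GSystem.{w, v, u} 𝒢 where
  fibre _ := OperatorSystem.ofCStarAlgebra (ULift.{w} ℂ)
  act _ := LinearMap.id
  act_iso _ := ⟨Function.bijective_id, rfl, fun _ _ => Iff.rfl⟩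
  act_mul _ _ _ := rfl

/-! ## Compact spaces with a groupoid action -/

/-- A compact `𝒢`-space: nonempty compact Hausdorff spaces indexed by the units, and
homeomorphisms `act g : X_{d(g)} → X_{r(g)}` that respect units and products. -/
structure GSpace (𝒢 : Type u) [Groupoid.{v} 𝒢] where
  fibre : 𝒢 → Type w
  [top : ∀ x, TopologicalSpace (fibre x)]
  [compact : ∀ x, CompactSpace (fibre x)]
  [hausdorff : ∀ x, T2Space (fibre x)]
  [nonempty : ∀ x, Nonempty (fibre x)]
  act : ∀ {x y : 𝒢}, (x ⟶ y) → (fibre x ≃ₜ fibre y)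
  act_id : ∀ (x : 𝒢) (p : fibre x), act (𝟙 x) p = p
  act_mul : ∀ {x y z : 𝒢} (h : x ⟶ y) (g : y ⟶ z) (p : fibre x),
    act (h ≫ g) p = act g (act h p)

namespace GSpace

attribute [instance] GSpace.top GSpace.compact GSpace.hausdorff GSpace.nonempty

/-- Each fibre carries its Borel σ-algebra. -/
instance instMeasurableSpaceFibre (X : GSpace.{w, v, u} 𝒢) (x : 𝒢) :
    MeasurableSpace (X.fibre x) := borel _

instance instBorelSpaceFibre (X : GSpace.{w, v, u} 𝒢) (x : 𝒢) : BorelSpace (X.fibre x) := ⟨rfl⟩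

/-- `X` is minimal: it has no closed invariant subbundle with nonempty fibres other than
itself. -/
def IsMinimal (X : GSpace.{w, v, u} 𝒢) : Prop :=
  ∀ Y : ∀ x, Set (X.fibre x), (∀ x, IsClosed (Y x)) → (∀ x, (Y x).Nonempty) →
    (∀ {x y : 𝒢} (g : x ⟶ y), X.act g '' Y x = Y y) → ∀ x, Y x = Set.univ

/-- The translate `g • μ` of a probability measure, `(g • μ)(E) = μ(g⁻¹ E)`. -/
def translate (X : GSpace.{w, v, u} 𝒢) {x y : 𝒢} (g : x ⟶ y)
    (μ : ProbabilityMeasure (X.fibre x)) : ProbabilityMeasure (X.fibre y) :=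
  μ.map (X.act g).continuous.measurable.aemeasurable

/-- `X` is strongly proximal: if there are arrows from `x` to `y`, then for each Radon probability
measure `μ` on the fibre over `x` the weak* closure of the set of the translates of `μ` by arrows
from `x` to `y` contains a point mass. -/
def IsStronglyProximal (X : GSpace.{w, v, u} 𝒢) : Prop :=
  ∀ x y : 𝒢, Nonempty (x ⟶ y) → ∀ μ : ProbabilityMeasure (X.fibre x),
    (μ : Measure (X.fibre x)).Regular →
      ∃ p : X.fibre y, diracProba p ∈ closure (Set.range fun g : x ⟶ y => X.translate g μ)

/-- `𝒢`-boundaries. -/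
def IsBoundary (X : GSpace.{w, v, u} 𝒢) : Prop :=
  X.IsMinimal ∧ X.IsStronglyProximal

/-- `Z` is a `𝒢`-quotient of `X`: there is an equivariant family of continuous surjections. -/
def HasQuotient (X Z : GSpace.{w, v, u} 𝒢) : Prop :=
  ∃ q : ∀ x, C(X.fibre x, Z.fibre x), (∀ x, Function.Surjective (q x)) ∧
    ∀ {x y : 𝒢} (g : x ⟶ y) (p : X.fibre x), Z.act g (q x p) = q y (X.act g p)

/-- `X` and `Y` are `𝒢`-isomorphic: there is an equivariant family of homeomorphisms. -/
def Isomorphic (X Y : GSpace.{w, v, u} 𝒢) : Prop :=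
  ∃ e : ∀ x, X.fibre x ≃ₜ Y.fibre x,
    ∀ {x y : 𝒢} (g : x ⟶ y) (p : X.fibre x), Y.act g (e x p) = e y (X.act g p)

/-- `X` is a Furstenberg boundary: a `𝒢`-boundary that has every `𝒢`-boundary as a quotient. -/
def IsFurstenbergBoundary (X : GSpace.{w, v, u} 𝒢) : Prop :=
  X.IsBoundary ∧ ∀ Z : GSpace.{w, v, u} 𝒢, Z.IsBoundary → X.HasQuotient Z

/-- The *-isomorphism `f ↦ f ∘ e⁻¹` of the algebras of continuous functions. -/
def pullback {S T : Type w} [TopologicalSpace S] [TopologicalSpace T] [CompactSpace S]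
    [CompactSpace T] (e : S ≃ₜ T) : C(S, ℂ) ≃⋆ₐ[ℂ] C(T, ℂ) where
  toFun f := f.comp (e.symm : C(T, S))
  invFun f := f.comp (e : C(S, T))
  left_inv f := by ext p; simp
  right_inv f := by ext p; simp
  map_mul' _ _ := rfl
  map_add' _ _ := rfl
  map_star' _ := rfl
  map_smul' _ _ := rfl

/-- The groupoid dynamical system of the algebras `C(X_x)` with the action
`(g • f)(p) = f(g⁻¹ p)`. -/
def functionSystem (X : GSpace.{w, v, u} 𝒢) : GSystem.{w, v, u} 𝒢 where
  fibre x := OperatorSystem.ofCStarAlgebra C(X.fibre x, ℂ)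
  act g := OperatorSystem.mapOfStarAlgEquiv (pullback (X.act g))
  act_iso g := OperatorSystem.isCompleteOrderIso_mapOfStarAlgEquiv _
  act_mul {x y z} h g a := by
    refine Subtype.ext (ContinuousMap.ext fun p => ?_)
    change a.1 ((X.act (h ≫ g)).symm p)
      = a.1 ((X.act h).symm ((X.act g).symm p))
    congr 1
    rw [Homeomorph.symm_apply_eq, X.act_mul]
    simp

/-- `X` is a Hamana boundary: the system of the algebras `C(X_x)` is an injective envelope of the
trivial system. (The embedding of the trivial system is the only possible one, `c ↦ c • 1`.) -/
def IsHamanaBoundary (X : GSpace.{w, v, u} 𝒢) : Prop :=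
  ∃ Θ : GMorphism (trivialSystem.{w} 𝒢) X.functionSystem, Θ.IsInjectiveEnvelope

end GSpace

end

/-!
The proof constructs one space `B` that is a Furstenberg boundary and a Hamana boundary, and
compares all others with it.

A morphism `C(Z) → C(Y)` is dual to an equivariant family of continuous maps from `Y_x` to the
probability measures on `Z_x`; restricted to real functions it is called a Markov map below. If `Z`
is strongly proximal, the points of `Y` whose measure is a point mass form a closed invariant family
with nonempty fibres (`MarkovMap.exists_isDiracAt`). So if `Y` is minimal, every morphism
`C(Z) → C(Y)` is the composition with an equivariant map `Y → Z`. Applied to the average of a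
morphism and the identity, this shows that a boundary `Z` is rigid: the only Markov map
`C(Z) → C(Z)` is the identity (`GSpace.IsBoundary.markovMap_eq`). In particular Furstenberg
boundaries are unique.

To construct `B`, consider the bounded functions on the set of arrows with range `y`, for each unit
`y`. By Zorn's lemma there is a minimal invariant family of sublinear functionals `p_y` dominated by
the supremum. `B_y` is the closure of the set of extreme points of the set of linear functionals
dominated by `p_y`. A supremum over a closed invariant subfamily of `B`, or over the orbit of a
measure on `B`, is again an invariant family of sublinear functionals below `p`, so that it is `p`.
As a probability measure whose barycentre is extreme is a point mass
(`apply_eq_zero_of_extreme`), this makes `B` minimal and strongly proximal.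

`C(B)` is injective for the following reason. Maps into `C(B)` are completely positive if they are
positive at every point (`OperatorSystem.isUCP_of_pointEval`). By rigidity, a morphism `Ψ` from a
system `A` into `C(B)` is recovered from the states that it induces at base points of the fibres, by
means of the Poisson transform `h ↦ σ(h⁻¹ a)` followed by the evaluation at the points of `B`, which
are functionals on bounded functions of arrows. By the Hahn–Banach theorem these states extend from
`A` to any system in which `A` embeds, and the Poisson transform of the extensions extends `Ψ`.

Injectivity provides morphisms `C(Z) → C(B)`, hence maps `B → Z`, for all boundaries `Z`, and
morphisms `C(Y) → C(B) → C(Y)` with composition the identity for every Hamana boundary `Y`. The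
second of the latter turns out to be the composition with a homeomorphism `Y → B`
(`GSpace.IsBoundary.isomorphic_of_isHamanaBoundary`).
-/

noncomputable section

open Filter Topology

variable {𝒢 : Type u} [Groupoid.{v} 𝒢]

/-! ### States on algebras of continuous functions -/

section States

/-- A state on an algebra of real functions: a positive linear functional of value `1` at `1`. -/
structure IsState {E : Type*} [AddCommGroup E] [Module ℝ E] [One E] [LE E]
    (s : E →ₗ[ℝ] ℝ) : Prop where
  nonneg : ∀ f, 0 ≤ f → 0 ≤ s f
  map_one : s 1 = 1

/-- A form of the Hahn–Banach theorem: a sublinear functional dominates a linear functional that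
attains it at a prescribed vector. -/
theorem exists_linear_le_eq {E : Type*} [AddCommGroup E] [Module ℝ E] (N : E → ℝ)
    (N_smul_le : ∀ c : ℝ, 0 < c → ∀ x, N (c • x) ≤ c * N x) (N_add : ∀ x y, N (x + y) ≤ N x + N y)
    (x₀ : E) : ∃ t : E →ₗ[ℝ] ℝ, (∀ x, t x ≤ N x) ∧ t x₀ = N x₀ := by
  have N_smul : ∀ c : ℝ, 0 < c → ∀ x, N (c • x) = c * N x := fun c hc x => by
    refine (N_smul_le c hc x).antisymm ?_
    have h := N_smul_le c⁻¹ (inv_pos.2 hc) (c • x)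
    rwa [inv_smul_smul₀ hc.ne', le_inv_mul_iff₀ hc] at h
  have N0 : N 0 = 0 := by
    have := N_smul 2 two_pos 0
    rw [smul_zero] at this
    linarith
  rcases eq_or_ne x₀ 0 with rfl | hx
  · obtain ⟨t, -, ht⟩ := exists_extension_of_le_sublinear (⟨⊥, 0⟩ : E →ₗ.[ℝ] ℝ) N N_smul N_add
      (by rintro ⟨x, hx⟩
          rw [Submodule.mem_bot] at hx
          simp [hx, N0])
    exact ⟨t, ht, by rw [map_zero, N0]⟩
  · obtain ⟨t, ht₀, ht⟩ := exists_extension_of_le_sublinear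
      (LinearPMap.mkSpanSingleton x₀ (N x₀) hx) N N_smul N_add (by
        rintro ⟨x, hx'⟩
        obtain ⟨c, rfl⟩ := Submodule.mem_span_singleton.1 hx'
        rw [LinearPMap.mkSpanSingleton'_apply, smul_eq_mul]
        change c * N x₀ ≤ N (c • x₀)
        rcases lt_trichotomy c 0 with hc | rfl | hc
        · have h1 := N_smul (-c) (neg_pos.2 hc) x₀
          have h2 := N_add (c • x₀) ((-c) • x₀)
          rw [← add_smul, add_neg_cancel, zero_smul, N0, h1] at h2
          linarith
        · simp [N0]
        · exact (N_smul c hc x₀).ge)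
    refine ⟨t, ht, ?_⟩
    have := ht₀ ⟨x₀, Submodule.mem_span_singleton_self _⟩
    rw [this]
    exact LinearPMap.mkSpanSingleton'_apply_self x₀ (N x₀) _ _

theorem IsState.mono {S : Type*} [TopologicalSpace S] {s : C(S, ℝ) →ₗ[ℝ] ℝ} (hs : IsState s)
    {f g : C(S, ℝ)} (hfg : f ≤ g) : s f ≤ s g := by
  have := hs.nonneg (g - f) (sub_nonneg.2 hfg)
  rw [map_sub] at this
  linarith

variable {S : Type*} [TopologicalSpace S] [CompactSpace S] [T2Space S]

/-- The Riesz–Markov–Kakutani theorem for states. -/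
theorem IsState.exists_probabilityMeasure [MeasurableSpace S] [BorelSpace S] {s : C(S, ℝ) →ₗ[ℝ] ℝ}
    (hs : IsState s) : ∃ μ : ProbabilityMeasure S, (μ : Measure S).Regular ∧
      ∀ f : C(S, ℝ), ∫ x, f x ∂(μ : Measure S) = s f := by
  let Λ : CompactlySupportedContinuousMap S ℝ →ₚ[ℝ] ℝ := PositiveLinearMap.mk₀
    { toFun := fun f => s f.toContinuousMap
      map_add' := fun f g => s.map_add f.toContinuousMap g.toContinuousMap
      map_smul' := fun c f => s.map_smul c f.toContinuousMap }
    (fun f hf => hs.nonneg _ fun x => hf x)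
  have key : ∀ f : C(S, ℝ), ∫ x, f x ∂(RealRMK.rieszMeasure Λ) = s f := fun f =>
    RealRMK.integral_rieszMeasure Λ (CompactlySupportedContinuousMap.continuousMapEquiv f)
  have h1 := key 1
  rw [hs.map_one] at h1
  have hprob : IsProbabilityMeasure (RealRMK.rieszMeasure Λ) := by
    constructor
    simp only [ContinuousMap.one_apply, integral_const, smul_eq_mul, mul_one] at h1
    exact (ENNReal.toReal_eq_one_iff _).1 h1
  exact ⟨⟨RealRMK.rieszMeasure Λ, hprob⟩, RealRMK.regular_rieszMeasure Λ, key⟩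

/-- In a compact Hausdorff space, nonnegative continuous functions vanishing at a point separate it
from the other points. -/
theorem eq_of_forall_nonneg_apply_eq_zero {a b : S}
    (h : ∀ f : C(S, ℝ), 0 ≤ f → f a = 0 → f b = 0) : a = b := by
  by_contra hab
  obtain ⟨f, hf0, hf1, hf⟩ := exists_continuous_zero_one_of_isClosed (isClosed_singleton (x := a))
    (isClosed_singleton (x := b)) (by simpa using hab)
  have h1 := h f (fun x => (hf x).1) (hf0 rfl)
  have h2 : f b = 1 := hf1 rfl
  linarith

theorem eq_of_forall_apply_eq {a b : S} (h : ∀ f : C(S, ℝ), f a = f b) : a = b :=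
  eq_of_forall_nonneg_apply_eq_zero fun f _ hf => by rw [← h f, hf]

/-- A positive unital functional that vanishes on the nonnegative functions vanishing at a point is
the evaluation at this point. -/
theorem IsState.eq_eval {S : Type*} [TopologicalSpace S] {s : C(S, ℝ) →ₗ[ℝ] ℝ} (hs : IsState s)
    {p : S}
    (h : ∀ f : C(S, ℝ), 0 ≤ f → f p = 0 → s f = 0) (f : C(S, ℝ)) : s f = f p := by
  have hmono : ∀ f g : C(S, ℝ), f ≤ g → s f ≤ s g := fun _ _ => hs.mono
  have h0 : s |f - f p • 1| = 0 := h _ (abs_nonneg _) (by simp)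
  have h1 := hmono _ _ (le_abs_self (f - f p • 1))
  have h2 := hmono _ _ (neg_le_abs (f - f p • 1))
  simp only [map_sub, map_neg, map_smul, hs.map_one, smul_eq_mul] at h1 h2
  linarith

end States

/-! ### Strong proximality in terms of states -/

namespace GSpace

/-- Composition of a function on the fibre over `y` with the action of an arrow `g : x ⟶ y`. -/
def compAct (X : GSpace.{w, v, u} 𝒢) {x y : 𝒢} (g : x ⟶ y) :
    C(X.fibre y, ℝ) →ₗ[ℝ] C(X.fibre x, ℝ) where
  toFun f := f.comp (X.act g : C(X.fibre x, X.fibre y))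
  map_add' _ _ := rfl
  map_smul' _ _ := rfl

@[simp] theorem compAct_apply (X : GSpace.{w, v, u} 𝒢) {x y : 𝒢} (g : x ⟶ y)
    (f : C(X.fibre y, ℝ)) (p : X.fibre x) : X.compAct g f p = f (X.act g p) := rfl

theorem act_act_inv (X : GSpace.{w, v, u} 𝒢) {x y : 𝒢} (g : x ⟶ y) (p : X.fibre y) :
    X.act g (X.act (Groupoid.inv g) p) = p := by
  rw [← X.act_mul, Groupoid.inv_comp, X.act_id]

theorem act_inv_act (X : GSpace.{w, v, u} 𝒢) {x y : 𝒢} (g : x ⟶ y) (p : X.fibre x) :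
    X.act (Groupoid.inv g) (X.act g p) = p := by
  rw [← X.act_mul, Groupoid.comp_inv, X.act_id]

theorem IsMinimal.eq_univ {X : GSpace.{w, v, u} 𝒢} (hX : X.IsMinimal)
    (Y : ∀ x, Set (X.fibre x)) (hc : ∀ x, IsClosed (Y x)) (hn : ∀ x, (Y x).Nonempty)
    (hi : ∀ {x y : 𝒢} (g : x ⟶ y) (p : X.fibre x), p ∈ Y x → X.act g p ∈ Y y) (x : 𝒢) :
    Y x = Set.univ := by
  refine hX Y hc hn (fun {x y} g => Set.Subset.antisymm ?_ ?_) x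
  · rintro _ ⟨p, hp, rfl⟩
    exact hi g p hp
  · exact fun p hp => ⟨_, hi (Groupoid.inv g) p hp, X.act_act_inv g p⟩

/-- Strong proximality in terms of states instead of measures: a translate of a state is
concentrated near `p` if it is small on a nonnegative function that vanishes at `p`. -/
def IsStateProximal (X : GSpace.{w, v, u} 𝒢) : Prop :=
  ∀ (x y : 𝒢), Nonempty (x ⟶ y) → ∀ s : C(X.fibre x, ℝ) →ₗ[ℝ] ℝ, IsState s →
    ∃ p : X.fibre y, ∀ f : C(X.fibre y, ℝ), 0 ≤ f → f p = 0 → ∀ ε > 0,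
      ∃ g : x ⟶ y, s (X.compAct g f) < ε

theorem integral_translate (X : GSpace.{w, v, u} 𝒢) {x y : 𝒢} (g : x ⟶ y)
    (μ : ProbabilityMeasure (X.fibre x)) (f : C(X.fibre y, ℝ)) :
    ∫ p, f p ∂(X.translate g μ : Measure (X.fibre y)) =
      ∫ p, X.compAct g f p ∂(μ : Measure (X.fibre x)) := by
  change ∫ p, f p ∂((μ : Measure (X.fibre x)).map (X.act g)) = _
  rw [integral_map (X.act g).continuous.measurable.aemeasurable
    f.continuous.measurable.aestronglyMeasurable]
  rfl

theorem IsStronglyProximal.isStateProximal {X : GSpace.{w, v, u} 𝒢} (hX : X.IsStronglyProximal) :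
    X.IsStateProximal := by
  intro x y hxy s hs
  obtain ⟨μ, hμ, hμs⟩ := hs.exists_probabilityMeasure
  obtain ⟨p, hp⟩ := hX x y hxy μ hμ
  refine ⟨p, fun f hf hfp ε hε => ?_⟩
  have hopen : IsOpen {ν : ProbabilityMeasure (X.fibre y) | ∫ q, f q ∂(ν : Measure _) < ε} :=
    isOpen_lt (ProbabilityMeasure.continuous_integral_continuousMap f) continuous_const
  obtain ⟨_, hν, g, rfl⟩ := mem_closure_iff.1 hp _ hopen (by
    change ∫ q, f q ∂(Measure.dirac p) < ε
    rwa [integral_dirac, hfp])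
  refine ⟨g, ?_⟩
  rw [← hμs, ← integral_translate]
  exact hν

theorem IsStateProximal.isStronglyProximal {X : GSpace.{w, v, u} 𝒢} (hX : X.IsStateProximal) :
    X.IsStronglyProximal := by
  intro x y hxy μ _
  have hint : ∀ f : C(X.fibre x, ℝ), Integrable f (μ : Measure (X.fibre x)) := fun f =>
    (BoundedContinuousFunction.mkOfCompact f).integrable _
  let s : C(X.fibre x, ℝ) →ₗ[ℝ] ℝ :=
    { toFun := fun f => ∫ p, f p ∂(μ : Measure (X.fibre x))
      map_add' := fun f g => integral_add (hint f) (hint g)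
      map_smul' := fun c f => integral_const_mul c f }
  have hs : IsState s := ⟨fun f hf => integral_nonneg hf, by
    change ∫ p, (1 : ℝ) ∂(μ : Measure (X.fibre x)) = 1
    simp⟩
  have hmono : ∀ f g : C(X.fibre x, ℝ), f ≤ g → s f ≤ s g := fun f g hfg =>
    integral_mono (hint f) (hint g) hfg
  obtain ⟨p, hp⟩ := hX x y hxy s hs
  refine ⟨p, ?_⟩
  -- The filter of the arrows `g` for which the translate of `μ` by `g` is concentrated near `p`.
  let I := {f : C(X.fibre y, ℝ) // 0 ≤ f ∧ f p = 0}
  let F : I → Filter (x ⟶ y) := fun f => comap (fun g => s (X.compAct g f.1)) (𝓝 0)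
  have hF : ∀ (f : I) (ε : ℝ), 0 < ε → {g | s (X.compAct g f.1) < ε} ∈ F f := fun f ε hε =>
    preimage_mem_comap (Iio_mem_nhds hε)
  have hpos : ∀ (f : I) (g : x ⟶ y), 0 ≤ s (X.compAct g f.1) := fun f g =>
    hs.nonneg _ fun q => f.2.1 _
  have : Nonempty I := ⟨⟨0, le_rfl, rfl⟩⟩
  have : NeBot (⨅ f, F f) := by
    refine iInf_neBot_of_directed' ?_ fun f => ?_
    · have hle : ∀ f₁ f₂ : I, f₂.1 ≤ f₁.1 → F f₁ ≤ F f₂ := by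
        intro f₁ f₂ h
        refine tendsto_iff_comap.1 ?_
        exact squeeze_zero (g := fun g => s (X.compAct g f₁.1)) (fun g => hpos f₂ g)
          (fun g => hmono _ _ fun q => h (X.act g q)) tendsto_comap
      intro f₁ f₂
      refine ⟨⟨f₁.1 + f₂.1, add_nonneg f₁.2.1 f₂.2.1, by simp [f₁.2.2, f₂.2.2]⟩, ?_, ?_⟩
      · exact hle _ _ (le_add_of_nonneg_right f₂.2.1)
      · exact hle _ _ (le_add_of_nonneg_left f₁.2.1)
    · refine comap_neBot_iff.2 fun t ht => ?_
      obtain ⟨ε, hε, hεt⟩ := Metric.mem_nhds_iff.1 ht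
      obtain ⟨g, hg⟩ := hp f.1 f.2.1 f.2.2 ε hε
      exact ⟨g, hεt (by rwa [Metric.mem_ball, Real.dist_0_eq_abs, abs_of_nonneg (hpos f g)])⟩
  refine mem_closure_of_tendsto (f := fun g => X.translate g μ) (b := ⨅ f, F f) ?_
    (Eventually.of_forall fun g => ⟨g, rfl⟩)
  rw [ProbabilityMeasure.tendsto_iff_forall_integral_tendsto]
  intro f
  change Tendsto _ _ (𝓝 (∫ q, f q ∂(Measure.dirac p)))
  rw [integral_dirac]
  let f' : C(X.fibre y, ℝ) := f.toContinuousMap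
  have hlim : Tendsto (fun g => s (X.compAct g |f' - f' p • 1|)) (⨅ f, F f) (𝓝 0) :=
    tendsto_comap.mono_left (iInf_le F ⟨|f' - f' p • 1|, abs_nonneg _, by simp⟩)
  rw [tendsto_iff_dist_tendsto_zero]
  refine squeeze_zero (fun _ => dist_nonneg) (fun g => ?_) hlim
  have h1 : ∫ q, f q ∂(X.translate g μ : Measure (X.fibre y)) = s (X.compAct g f') :=
    X.integral_translate g μ f'
  have h2 : s (X.compAct g f') - f p = s (X.compAct g (f' - f' p • 1)) := by
    have : X.compAct g (f' - f' p • 1) = X.compAct g f' - f' p • 1 := rfl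
    rw [this, map_sub, map_smul, hs.map_one, smul_eq_mul, mul_one]
    rfl
  rw [h1, Real.dist_eq, h2, abs_le]
  constructor
  · rw [neg_le, ← map_neg]
    exact hmono _ _ fun q => neg_le_abs _
  · exact hmono _ _ fun q => le_abs_self _

theorem isBoundary_iff {X : GSpace.{w, v, u} 𝒢} :
    X.IsBoundary ↔ X.IsMinimal ∧ X.IsStateProximal :=
  ⟨fun h => ⟨h.1, h.2.isStateProximal⟩, fun h => ⟨h.1, h.2.isStronglyProximal⟩⟩

end GSpace

/-! ### Markov maps -/

/-- An equivariant family of positive unital maps `C(Z_x, ℝ) → C(Y_x, ℝ)`. Dually, it is an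
equivariant family of continuous maps from `Y_x` to the probability measures on `Z_x`. -/
structure MarkovMap (Z Y : GSpace.{w, v, u} 𝒢) where
  map : ∀ x, C(Z.fibre x, ℝ) →ₗ[ℝ] C(Y.fibre x, ℝ)
  nonneg : ∀ x f, 0 ≤ f → 0 ≤ map x f
  map_one : ∀ x, map x 1 = 1
  equivariant : ∀ {x y : 𝒢} (g : x ⟶ y) (f : C(Z.fibre y, ℝ)),
    map x (Z.compAct g f) = Y.compAct g (map y f)

namespace MarkovMap

variable {Z Y : GSpace.{w, v, u} 𝒢} (Φ : MarkovMap Z Y)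

/-- The functional `f ↦ (Φ f)(q)`. -/
def evalAt {x : 𝒢} (q : Y.fibre x) : C(Z.fibre x, ℝ) →ₗ[ℝ] ℝ :=
  (ContinuousMap.evalCLM ℝ q).toLinearMap ∘ₗ Φ.map x

@[simp] theorem evalAt_apply {x : 𝒢} (q : Y.fibre x) (f : C(Z.fibre x, ℝ)) :
    Φ.evalAt q f = Φ.map x f q := rfl

theorem isState_evalAt {x : 𝒢} (q : Y.fibre x) : IsState (Φ.evalAt q) where
  nonneg f hf := Φ.nonneg x f hf q
  map_one := by simp [Φ.map_one]

/-- The measure that `Φ` assigns to `q` is the point mass at `p`. -/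
def IsDiracAt {x : 𝒢} (q : Y.fibre x) (p : Z.fibre x) : Prop :=
  ∀ f : C(Z.fibre x, ℝ), Φ.map x f q = f p

variable {Φ}

theorem IsDiracAt.act {x y : 𝒢} (g : x ⟶ y) {q : Y.fibre x} {p : Z.fibre x}
    (h : Φ.IsDiracAt q p) : Φ.IsDiracAt (Y.act g q) (Z.act g p) := fun f => by
  rw [← GSpace.compAct_apply, ← Φ.equivariant, h, GSpace.compAct_apply]

theorem IsDiracAt.unique {x : 𝒢} {q : Y.fibre x} {p p' : Z.fibre x}
    (h : Φ.IsDiracAt q p) (h' : Φ.IsDiracAt q p') : p = p' :=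
  eq_of_forall_apply_eq fun f => by rw [← h f, h' f]

variable (Φ)

theorem isClosed_setOf_isDiracAt (x : 𝒢) :
    IsClosed {a : Y.fibre x × Z.fibre x | Φ.IsDiracAt a.1 a.2} := by
  simp only [IsDiracAt, Set.ofPred_forall]
  exact isClosed_iInter fun f => isClosed_eq (by fun_prop) (by fun_prop)

/-- If `Z` is strongly proximal, then `Φ` assigns a point mass to some point of each fibre of `Y`:
the translates of the measure at any point concentrate, and compactness of the fibre gives a point
that has the limit as its measure. -/
theorem exists_isDiracAt (hZ : Z.IsStateProximal) (x : 𝒢) :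
    ∃ (q : Y.fibre x) (p : Z.fibre x), Φ.IsDiracAt q p := by
  obtain ⟨q₀⟩ := Y.nonempty x
  obtain ⟨p, hp⟩ := hZ x x ⟨𝟙 x⟩ _ (Φ.isState_evalAt q₀)
  let I := {f : C(Z.fibre x, ℝ) // 0 ≤ f ∧ f p = 0}
  have : Nonempty I := ⟨⟨0, le_rfl, rfl⟩⟩
  let A : I → Set (Y.fibre x) := fun f => {q | Φ.map x f.1 q ≤ 0}
  have hA : ∀ f, IsClosed (A f) := fun f => isClosed_le (by fun_prop) continuous_const
  have hdir : Directed (· ⊇ ·) A := by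
    intro f₁ f₂
    refine ⟨⟨f₁.1 + f₂.1, add_nonneg f₁.2.1 f₂.2.1, by simp [f₁.2.2, f₂.2.2]⟩, ?_, ?_⟩
    all_goals
      intro q hq
      have h1 : 0 ≤ Φ.map x f₁.1 q := Φ.nonneg x f₁.1 f₁.2.1 q
      have h2 : 0 ≤ Φ.map x f₂.1 q := Φ.nonneg x f₂.1 f₂.2.1 q
      have h3 : Φ.map x (f₁.1 + f₂.1) q ≤ 0 := hq
      rw [map_add, ContinuousMap.add_apply] at h3
      change Φ.map x _ q ≤ 0
      linarith
  have hne : ∀ f, (A f).Nonempty := by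
    intro f
    obtain ⟨q, -, hq⟩ := isCompact_univ.exists_isMinOn (Set.univ_nonempty (α := Y.fibre x))
      (Φ.map x f.1).continuous.continuousOn
    refine ⟨q, show Φ.map x f.1 q ≤ 0 from le_of_forall_pos_le_add fun ε hε => ?_⟩
    obtain ⟨g, hg⟩ := hp f.1 f.2.1 f.2.2 ε hε
    rw [evalAt_apply, Φ.equivariant, GSpace.compAct_apply] at hg
    rw [zero_add]
    exact (hq (Set.mem_univ _)).trans hg.le
  obtain ⟨q, hq⟩ := IsCompact.nonempty_iInter_of_directed_nonempty_isCompact_isClosed A hdir hne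
    (fun f => (hA f).isCompact) hA
  refine ⟨q, p, (Φ.isState_evalAt q).eq_eval fun f hf hfp => ?_⟩
  exact le_antisymm (Set.mem_iInter.1 hq ⟨f, hf, hfp⟩) (Φ.nonneg x f hf q)

theorem isClosed_setOf_exists_isDiracAt (x : 𝒢) :
    IsClosed {q : Y.fibre x | ∃ p, Φ.IsDiracAt q p} := by
  convert isClosedMap_fst_of_compactSpace _ (Φ.isClosed_setOf_isDiracAt x) using 1
  ext q
  simp

/-- A Markov map from a strongly proximal space to a minimal one assigns a point mass to every
point, as the points with this property form a closed invariant family. -/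
theorem exists_isDiracAt_left (hZ : Z.IsStateProximal) (hY : Y.IsMinimal) {x : 𝒢}
    (q : Y.fibre x) : ∃ p, Φ.IsDiracAt q p := by
  have h := hY.eq_univ (fun x => {q | ∃ p, Φ.IsDiracAt q p})
    (fun x => Φ.isClosed_setOf_exists_isDiracAt x)
    (fun x => Φ.exists_isDiracAt hZ x) (fun g q ⟨p, hp⟩ => ⟨_, hp.act g⟩) x
  exact h.ge (Set.mem_univ q)

theorem exists_isDiracAt_right (hZ : Z.IsStateProximal) (hZ' : Z.IsMinimal) {x : 𝒢}
    (p : Z.fibre x) : ∃ q, Φ.IsDiracAt q p := by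
  have h := hZ'.eq_univ (fun x => {p | ∃ q, Φ.IsDiracAt q p}) (fun x => ?_)
    (fun x => let ⟨q, p, h⟩ := Φ.exists_isDiracAt hZ x; ⟨p, q, h⟩)
    (fun g p ⟨q, hp⟩ => ⟨_, hp.act g⟩) x
  · exact h.ge (Set.mem_univ p)
  · convert isClosedMap_snd_of_compactSpace _ (Φ.isClosed_setOf_isDiracAt x) using 1
    ext q
    simp

/-- If `Φ` assigns a point mass to every point, and `Z` is minimal and strongly proximal, then `Φ`
is the composition with an equivariant family of continuous surjections `Y_x → Z_x`. -/
theorem exists_quotient (hZ : Z.IsStateProximal) (hZ' : Z.IsMinimal)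
    (h : ∀ (x : 𝒢) (q : Y.fibre x), ∃ p, Φ.IsDiracAt q p) :
    ∃ r : ∀ x, C(Y.fibre x, Z.fibre x), (∀ x, Function.Surjective (r x)) ∧
      (∀ {x y : 𝒢} (g : x ⟶ y) (p : Y.fibre x), Z.act g (r x p) = r y (Y.act g p)) ∧
      ∀ x q, Φ.IsDiracAt q (r x q) := by
  choose r hr using h
  have hc : ∀ x, Continuous (r x) := fun x => by
    refine continuous_iff_isClosed.2 fun C hC => ?_
    have : r x ⁻¹' C = Prod.fst '' ({a : Y.fibre x × Z.fibre x | Φ.IsDiracAt a.1 a.2} ∩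
        Prod.snd ⁻¹' C) := by
      ext q
      constructor
      · exact fun hq => ⟨(q, r x q), ⟨hr x q, hq⟩, rfl⟩
      · rintro ⟨⟨q, p⟩, ⟨hqp, hp⟩, rfl⟩
        change r x q ∈ C
        rwa [(hr x q).unique hqp]
    rw [this]
    exact isClosedMap_fst_of_compactSpace _
      ((Φ.isClosed_setOf_isDiracAt x).inter (hC.preimage continuous_snd))
  refine ⟨fun x => ⟨r x, hc x⟩, fun x p => ?_, fun {x y} g q => ?_, hr⟩
  · obtain ⟨q, hq⟩ := Φ.exists_isDiracAt_right hZ hZ' p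
    exact ⟨q, (hr x q).unique hq⟩
  · exact ((hr x q).act g).unique (hr y _)

end MarkovMap

/-! ### Rigidity of boundaries -/

namespace GSpace

/-- Rigidity of boundaries. The average of `Φ` and the identity assigns a point mass to every
point; as point masses are extreme, so does `Φ`, with the same point. -/
theorem IsBoundary.markovMap_eq {Z : GSpace.{w, v, u} 𝒢} (hZ : Z.IsBoundary)
    (Φ : MarkovMap Z Z) (x : 𝒢) (f : C(Z.fibre x, ℝ)) : Φ.map x f = f := by
  obtain ⟨hZm, hZp⟩ := isBoundary_iff.1 hZ
  -- The average of the identity and `Φ`.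
  let Ψ : MarkovMap Z Z :=
    { map := fun x => (1 / 2 : ℝ) • (LinearMap.id + Φ.map x)
      nonneg := fun x f hf q => by
        have h1 : 0 ≤ f q := hf q
        have h2 : 0 ≤ Φ.map x f q := Φ.nonneg x f hf q
        change (0 : ℝ) ≤ ((1 / 2 : ℝ) • ((LinearMap.id : C(Z.fibre x, ℝ) →ₗ[ℝ] _) + Φ.map x)) f q
        simp only [LinearMap.smul_apply, LinearMap.add_apply, LinearMap.id_apply,
          ContinuousMap.smul_apply, ContinuousMap.add_apply, smul_eq_mul]
        positivity
      map_one := fun x => by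
        ext q
        simp [Φ.map_one]
        norm_num
      equivariant := fun g f => by
        ext q
        simp [Φ.equivariant] }
  have hΨ : ∀ f q, Ψ.map x f q = 1 / 2 * (f q + Φ.map x f q) := fun f q => rfl
  ext q
  obtain ⟨p, hp⟩ := Ψ.exists_isDiracAt_left hZp hZm q
  have hpq : p = q := eq_of_forall_nonneg_apply_eq_zero fun f hf hfp => by
    have h1 := hp f
    have h2 : 0 ≤ f q := hf q
    have h3 : 0 ≤ Φ.map x f q := Φ.nonneg x f hf q
    rw [hΨ, hfp] at h1
    linarith
  have h1 := hp f
  rw [hΨ, hpq] at h1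
  linarith

/-- The Markov map of an equivariant family of continuous maps. -/
def markovMap {Y Z : GSpace.{w, v, u} 𝒢} (r : ∀ x, C(Y.fibre x, Z.fibre x))
    (hr : ∀ {x y : 𝒢} (g : x ⟶ y) (p : Y.fibre x), Z.act g (r x p) = r y (Y.act g p)) :
    MarkovMap Z Y where
  map x :=
    { toFun := fun f => f.comp (r x)
      map_add' := fun _ _ => rfl
      map_smul' := fun _ _ => rfl }
  nonneg x f hf := fun p => hf (r x p)
  map_one x := rfl
  equivariant g f := by
    ext p
    exact congrArg f (hr g p)

/-- Equivariant continuous self-maps of a boundary are trivial. -/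
theorem IsBoundary.eq_id {Z : GSpace.{w, v, u} 𝒢} (hZ : Z.IsBoundary)
    (r : ∀ x, C(Z.fibre x, Z.fibre x))
    (hr : ∀ {x y : 𝒢} (g : x ⟶ y) (p : Z.fibre x), Z.act g (r x p) = r y (Z.act g p))
    (x : 𝒢) (p : Z.fibre x) : r x p = p :=
  eq_of_forall_apply_eq fun f =>
    DFunLike.congr_fun (hZ.markovMap_eq (markovMap r hr) x f) p

theorem IsBoundary.hasQuotient {Y Z : GSpace.{w, v, u} 𝒢} (hZ : Z.IsBoundary) (hY : Y.IsMinimal)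
    (Φ : MarkovMap Z Y) : Y.HasQuotient Z := by
  obtain ⟨hZm, hZp⟩ := isBoundary_iff.1 hZ
  obtain ⟨r, hr, hr', -⟩ := Φ.exists_quotient hZp hZm fun x q =>
    Φ.exists_isDiracAt_left hZp hY q
  exact ⟨r, hr, hr'⟩

theorem Isomorphic.symm {X Y : GSpace.{w, v, u} 𝒢} (h : X.Isomorphic Y) : Y.Isomorphic X := by
  obtain ⟨e, he⟩ := h
  refine ⟨fun x => (e x).symm, fun {x y} g p => ?_⟩
  rw [Homeomorph.eq_symm_apply, ← he, Homeomorph.apply_symm_apply]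

theorem Isomorphic.trans {X Y Z : GSpace.{w, v, u} 𝒢} (h : X.Isomorphic Y) (h' : Y.Isomorphic Z) :
    X.Isomorphic Z := by
  obtain ⟨e, he⟩ := h
  obtain ⟨e', he'⟩ := h'
  exact ⟨fun x => (e x).trans (e' x), fun {x y} g p => by simp [he', he]⟩

theorem isomorphic_of_bijective {X Y : GSpace.{w, v, u} 𝒢} (r : ∀ x, C(X.fibre x, Y.fibre x))
    (hb : ∀ x, Function.Bijective (r x))
    (hr : ∀ {x y : 𝒢} (g : x ⟶ y) (p : X.fibre x), Y.act g (r x p) = r y (X.act g p)) :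
    X.Isomorphic Y :=
  ⟨fun x => (r x).continuous.homeoOfEquivCompactToT2 (f := Equiv.ofBijective _ (hb x)), hr⟩

/-- Furstenberg boundaries are unique. -/
theorem IsFurstenbergBoundary.isomorphic {X Y : GSpace.{w, v, u} 𝒢}
    (hX : X.IsFurstenbergBoundary) (hY : Y.IsFurstenbergBoundary) : X.Isomorphic Y := by
  obtain ⟨r, hrs, hr⟩ := hX.2 Y hY.1
  obtain ⟨t, hts, ht⟩ := hY.2 X hX.1
  refine isomorphic_of_bijective r (fun x => ⟨?_, hrs x⟩) hr
  refine Function.LeftInverse.injective (g := t x) fun p => ?_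
  exact hX.1.eq_id (fun x => (t x).comp (r x)) (fun g p => by simp [ht, hr]) x p

end GSpace

/-! ### Measures with extreme barycentre -/

section Extreme

variable {V Y : Type*} [AddCommGroup V] [Module ℝ V] [TopologicalSpace Y]
  {ev : V →ₗ[ℝ] C(Y, ℝ)} {p : V → ℝ} {e : V →ₗ[ℝ] ℝ}

/-- If the barycentre `e` of a state `t` is extreme, then `t` is concentrated on the fibres of all
coordinate functions `ev h`: otherwise `e` would be a proper convex combination of the barycentres
of `t` with the densities `ψ` and `1 - ψ`, where `ψ` is an affine function of `ev h`. -/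
theorem apply_sq_sub_eq_zero [CompactSpace Y] (hev : ∀ f y, ev f y ≤ p f)
    (he : ∀ (s₁ s₂ : V →ₗ[ℝ] ℝ) (c : ℝ), 0 < c → c < 1 → (∀ f, s₁ f ≤ p f) → (∀ f, s₂ f ≤ p f) →
      c • s₁ + (1 - c) • s₂ = e → s₁ = e)
    {t : C(Y, ℝ) →ₗ[ℝ] ℝ} (ht : IsState t) (hte : ∀ f, t (ev f) = e f) (h : V) :
    t ((ev h - e h • 1) ^ 2) = 0 := by
  have hmono : ∀ f g : C(Y, ℝ), f ≤ g → t f ≤ t g := fun _ _ => ht.mono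
  -- As `m` exceeds the norm of `ev h`, the values of `ψ` below, and thus `c = t ψ`, lie strictly
  -- between `0` and `1`.
  set m : ℝ := ‖ev h‖ + 1 with hm
  have hm0 : 0 < m := by positivity
  have hb : ∀ y, |ev h y| ≤ ‖ev h‖ := fun y => (ev h).norm_coe_le_norm y
  have hle : |e h| ≤ ‖ev h‖ := by
    have h1 := hmono (ev h) (‖ev h‖ • 1) fun y => by simpa using (abs_le.1 (hb y)).2
    have h2 := hmono (-(‖ev h‖ • 1)) (ev h) fun y => by simpa using (abs_le.1 (hb y)).1
    rw [map_neg, map_smul, ht.map_one, smul_eq_mul, mul_one, hte] at h2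
    rw [map_smul, ht.map_one, smul_eq_mul, mul_one, hte] at h1
    exact abs_le.2 ⟨h2, h1⟩
  obtain ⟨hle1, hle2⟩ := abs_le.1 hle
  set ψ : C(Y, ℝ) := (2 * m)⁻¹ • (ev h + m • 1) with hψ
  set c : ℝ := (2 * m)⁻¹ * (e h + m) with hc
  have htψ : t ψ = c := by
    rw [hψ, map_smul, map_add, map_smul, ht.map_one, hte, hc]
    simp
  have hψ0 : 0 ≤ ψ := fun y => by
    have := (abs_le.1 (hb y)).1
    change (0 : ℝ) ≤ (2 * m)⁻¹ * (ev h y + m * 1)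
    have : 0 ≤ ev h y + m * 1 := by linarith
    positivity
  have hψ1 : 0 ≤ 1 - ψ := fun y => by
    have := (abs_le.1 (hb y)).2
    change (0 : ℝ) ≤ 1 - (2 * m)⁻¹ * (ev h y + m * 1)
    rw [sub_nonneg, inv_mul_le_one₀ (by positivity)]
    linarith
  have hc0 : 0 < c := mul_pos (by positivity) (by linarith)
  have hc1 : c < 1 := by
    rw [hc, inv_mul_lt_one₀ (by positivity)]
    linarith
  -- The barycentre of the state with density `χ`, for `χ = ψ` and `χ = 1 - ψ`.
  let s : C(Y, ℝ) → V →ₗ[ℝ] ℝ := fun χ =>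
    (t χ)⁻¹ • (t ∘ₗ LinearMap.mulLeft ℝ χ ∘ₗ ev)
  have hs : ∀ χ f, s χ f = (t χ)⁻¹ * t (χ * ev f) := fun χ f => rfl
  have hsp : ∀ χ, 0 ≤ χ → 0 < t χ → ∀ f, s χ f ≤ p f := fun χ h0 hpos f => by
    rw [hs, inv_mul_le_iff₀ hpos]
    have := hmono (χ * ev f) (p f • χ) fun y => by
      change χ y * ev f y ≤ p f * χ y
      rw [mul_comm]
      exact mul_le_mul_of_nonneg_right (hev f y) (h0 y)
    rw [map_smul, smul_eq_mul] at this
    linarith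
  have ht1ψ : t (1 - ψ) = 1 - c := by rw [map_sub, ht.map_one, htψ]
  have key := he (s ψ) (s (1 - ψ)) c hc0 hc1 (hsp ψ hψ0 (htψ ▸ hc0))
    (hsp _ hψ1 (by rw [ht1ψ]; linarith)) (by
      ext f
      simp only [LinearMap.add_apply, LinearMap.smul_apply, smul_eq_mul, hs, htψ, ht1ψ]
      rw [mul_inv_cancel_left₀ hc0.ne', mul_inv_cancel_left₀ (sub_pos.2 hc1).ne', ← map_add,
        ← hte]
      congr 1
      ring)
  have h1 : t (ψ * ev h) = c * e h := by
    rw [← key, hs, htψ, mul_inv_cancel_left₀ hc0.ne']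
  have h2 : ψ * ev h = (2 * m)⁻¹ • (ev h ^ 2 + m • ev h) := by
    ext y
    simp [hψ]
    ring
  have h3 : t (ev h ^ 2) = e h ^ 2 := by
    rw [h2, map_smul, map_add, map_smul, hte, hc, smul_eq_mul, smul_eq_mul, mul_assoc] at h1
    have := mul_left_cancel₀ (by positivity) h1
    linarith
  have h4 : (ev h - e h • 1) ^ 2 = ev h ^ 2 - (2 * e h) • ev h + (e h ^ 2) • 1 := by
    ext y
    simp
    ring
  rw [h4, map_add, map_sub, map_smul, map_smul, h3, ht.map_one, hte]
  simp
  ring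

/-- A state with extreme barycentre `e` vanishes on the nonnegative functions that are zero at the
points of `Y` representing `e`. -/
theorem apply_eq_zero_of_extreme [CompactSpace Y] (hev : ∀ f y, ev f y ≤ p f)
    (he : ∀ (s₁ s₂ : V →ₗ[ℝ] ℝ) (c : ℝ), 0 < c → c < 1 → (∀ f, s₁ f ≤ p f) → (∀ f, s₂ f ≤ p f) →
      c • s₁ + (1 - c) • s₂ = e → s₁ = e)
    {t : C(Y, ℝ) →ₗ[ℝ] ℝ} (ht : IsState t) (hte : ∀ f, t (ev f) = e f)
    {F : C(Y, ℝ)} (hF : 0 ≤ F) (hFe : ∀ y, (∀ f, ev f y = e f) → F y = 0) : t F = 0 := by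
  refine le_antisymm (le_of_forall_pos_le_add fun δ hδ => ?_) (ht.nonneg F hF)
  -- On the compact set where `F ≥ δ` no point represents `e`, so that a finite sum of multiples of
  -- the squares `(ev h - e h)²`, on which `t` vanishes, is at least `1` there.
  obtain ⟨G, hG0, hG, hG1⟩ : ∃ G : C(Y, ℝ), 0 ≤ G ∧ t G = 0 ∧ ∀ y ∈ {y | δ ≤ F y}, 1 ≤ G y := by
    refine IsCompact.induction_on (p := fun s => ∃ G : C(Y, ℝ), 0 ≤ G ∧ t G = 0 ∧ ∀ y ∈ s, 1 ≤ G y)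
      (isClosed_le continuous_const F.continuous).isCompact ?_ ?_ ?_ ?_
    · exact ⟨0, le_rfl, map_zero t, fun y hy => hy.elim⟩
    · rintro s s' hss ⟨G, hG0, hG, hG1⟩
      exact ⟨G, hG0, hG, fun y hy => hG1 y (hss hy)⟩
    · rintro s s' ⟨G, hG0, hG, hG1⟩ ⟨G', hG0', hG', hG1'⟩
      refine ⟨G + G', add_nonneg hG0 hG0', by rw [map_add, hG, hG', add_zero], ?_⟩
      have h0 : ∀ y, 0 ≤ G y := fun y => hG0 y
      have h0' : ∀ y, 0 ≤ G' y := fun y => hG0' y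
      rintro y (hy | hy)
      · exact (hG1 y hy).trans (le_add_of_nonneg_right (h0' y))
      · exact (hG1' y hy).trans (le_add_of_nonneg_left (h0 y))
    · intro y hy
      obtain ⟨h, hh⟩ : ∃ h, ev h y ≠ e h := by
        by_contra! H
        have := hFe y H
        have hy' : δ ≤ F y := hy
        linarith
      set a : ℝ := (ev h y - e h) ^ 2 with ha
      have ha0 : 0 < a := by
        have := sub_ne_zero.2 hh
        positivity
      let G : C(Y, ℝ) := (2 * a⁻¹) • (ev h - e h • 1) ^ 2
      have hGv : ∀ z, G z = (2 * a⁻¹) * (ev h z - e h) ^ 2 := fun z => by simp [G]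
      refine ⟨{z | 1 < G z}, mem_nhdsWithin_of_mem_nhds ?_, G, fun z => ?_, ?_, fun z hz => hz.le⟩
      · refine (isOpen_lt continuous_const G.continuous).mem_nhds ?_
        change 1 < G y
        rw [hGv, ← ha, inv_mul_cancel_right₀ ha0.ne']
        norm_num
      · change 0 ≤ G z
        rw [hGv]
        positivity
      · rw [map_smul, apply_sq_sub_eq_zero hev he ht hte, smul_zero]
  have h1 : 0 ≤ t (δ • 1 + ‖F‖ • G - F) := ht.nonneg _ fun y => by
    change (0 : ℝ) ≤ δ * 1 + ‖F‖ * G y - F y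
    have h0 : 0 ≤ G y := hG0 y
    rcases le_or_gt δ (F y) with hy | hy
    · have h2 := hG1 y hy
      have h3 : F y ≤ ‖F‖ := (le_abs_self _).trans (F.norm_coe_le_norm y)
      nlinarith [norm_nonneg F]
    · have := mul_nonneg (norm_nonneg F) h0
      linarith
  rw [map_sub, map_add, map_smul, map_smul, hG, ht.map_one] at h1
  simp only [smul_eq_mul] at h1
  linarith

/-- At an extreme point `e`, the upper envelope of a nonnegative function that vanishes at `e` is
zero. Here `ev f` is the function on `Y` given by the vector `f`, and the hypotheses `hev` and
`hp` say that `p f` is its maximum. -/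
theorem exists_le_ev_and_apply_lt [CompactSpace Y] {i : V} (hi : ev i = 1)
    (hev : ∀ f y, ev f y ≤ p f) (hp : ∀ f C, (∀ y, ev f y ≤ C) → p f ≤ C)
    (hep : ∀ f, e f ≤ p f)
    (he : ∀ (s₁ s₂ : V →ₗ[ℝ] ℝ) (c : ℝ), 0 < c → c < 1 → (∀ f, s₁ f ≤ p f) → (∀ f, s₂ f ≤ p f) →
      c • s₁ + (1 - c) • s₂ = e → s₁ = e)
    {F : C(Y, ℝ)} (hF : 0 ≤ F) (hFe : ∀ y, (∀ f, ev f y = e f) → F y = 0) {ε : ℝ} (hε : 0 < ε) :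
    ∃ h, F ≤ ev h ∧ e h < ε := by
  have hei : e i = 1 := by
    have h1 := (hep i).trans (hp i 1 fun y => by simp [hi])
    have h2 := (hep (-i)).trans (hp (-i) (-1) fun y => by simp [hi])
    rw [map_neg] at h2
    linarith
  -- The infimum `N` of these sets is the upper envelope at `e`; a linear functional dominated by it
  -- is a state with barycentre `e`.
  let A : C(Y, ℝ) → Set ℝ := fun F => {a | ∃ h, F ≤ ev h ∧ e h = a}
  have hne : ∀ F, (A F).Nonempty := fun F => ⟨_, ‖F‖ • i, fun y => by
    rw [map_smul, hi]
    change F y ≤ ‖F‖ * 1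
    rw [mul_one]
    exact (le_abs_self _).trans (F.norm_coe_le_norm y), rfl⟩
  have hbdd : ∀ F, BddBelow (A F) := fun F => by
    refine ⟨-‖F‖, ?_⟩
    rintro _ ⟨h, hh, rfl⟩
    have h1 := (hep (-h)).trans (hp (-h) ‖F‖ fun y => by
      have h1 : F y ≤ ev h y := hh y
      have h2 := (abs_le.1 (F.norm_coe_le_norm y)).1
      rw [map_neg, ContinuousMap.neg_apply]
      linarith)
    rw [map_neg] at h1
    linarith
  let N : C(Y, ℝ) → ℝ := fun F => sInf (A F)
  have hN : ∀ F h, F ≤ ev h → N F ≤ e h := fun F h hh => csInf_le (hbdd F) ⟨h, hh, rfl⟩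
  have hN' : ∀ F a, (∀ h, F ≤ ev h → a ≤ e h) → a ≤ N F := fun F a H =>
    le_csInf (hne F) (by rintro _ ⟨h, hh, rfl⟩; exact H h hh)
  obtain ⟨t, htN, htF⟩ := exists_linear_le_eq N (fun c hc x => by
      rw [← inv_mul_le_iff₀ hc]
      refine hN' _ _ fun h hh => ?_
      rw [inv_mul_le_iff₀ hc, ← smul_eq_mul, ← map_smul]
      exact hN _ _ (by rw [map_smul]; exact smul_le_smul_of_nonneg_left hh hc.le))
    (fun x y => by
      rw [← sub_le_iff_le_add]
      refine hN' _ _ fun h hh => ?_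
      rw [sub_le_comm]
      refine hN' _ _ fun h' hh' => ?_
      rw [sub_le_iff_le_add, add_comm, ← map_add]
      exact hN _ _ (by rw [map_add]; exact add_le_add hh' hh)) F
  have hte : ∀ f, t (ev f) = e f := fun f => by
    have h1 := (htN (ev f)).trans (hN _ f le_rfl)
    have h2 := (htN (ev (-f))).trans (hN _ (-f) le_rfl)
    rw [map_neg, map_neg, map_neg] at h2
    linarith
  have ht : IsState t := by
    refine ⟨fun f hf => ?_, by rw [← hi, hte, hei]⟩
    have := (htN (-f)).trans (hN _ 0 (by simpa using hf))
    rw [map_neg, map_zero] at this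
    linarith
  rw [apply_eq_zero_of_extreme hev he ht hte hF hFe] at htF
  obtain ⟨_, ⟨h, hh, rfl⟩, hlt⟩ := exists_lt_of_csInf_lt (hne F) (htF.symm.trans_lt hε)
  exact ⟨h, hh, hlt⟩

end Extreme

/-! ### Minimal invariant sublinear functionals and their extreme points -/

/-- The arrows with range `y`. -/
def ArrowsInto (y : 𝒢) : Type (max u v w) := ULift.{w} (Σ x : 𝒢, x ⟶ y)

namespace ArrowsInto

/-- The arrow `h`, as an element of the set of arrows with range `y`. -/
def mk {x y : 𝒢} (h : x ⟶ y) : ArrowsInto.{w} y := ⟨⟨x, h⟩⟩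

/-- The source of an arrow. -/
def source {y : 𝒢} (a : ArrowsInto.{w} y) : 𝒢 := a.down.1

/-- The underlying arrow of the groupoid. -/
def hom {y : 𝒢} (a : ArrowsInto.{w} y) : a.source ⟶ y := a.down.2

/-- The product of an arrow with range `x` and an arrow from `x` to `y`. -/
def postcomp {x y : 𝒢} (g : x ⟶ y) (a : ArrowsInto.{w} x) : ArrowsInto.{w} y := mk (a.hom ≫ g)

theorem postcomp_comp {x y z : 𝒢} (g : x ⟶ y) (k : y ⟶ z) (a : ArrowsInto.{w} x) :
    postcomp (g ≫ k) a = postcomp k (postcomp g a) :=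
  congrArg mk (Category.assoc a.hom g k).symm

theorem postcomp_id {x : 𝒢} (a : ArrowsInto.{w} x) : postcomp (𝟙 x) a = a :=
  congrArg mk (Category.comp_id a.hom)

instance (y : 𝒢) : Nonempty (ArrowsInto.{w} y) := ⟨mk (𝟙 y)⟩

instance (y : 𝒢) : TopologicalSpace (ArrowsInto.{w} y) := ⊥

instance (y : 𝒢) : DiscreteTopology (ArrowsInto.{w} y) := ⟨rfl⟩

end ArrowsInto

/-- Bounded real functions on the set of arrows with range `y`. -/
abbrev ArrowFun (y : 𝒢) : Type (max u v w) :=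
  BoundedContinuousFunction (ArrowsInto.{w} y) ℝ

/-- Composition of a function on the arrows into `y` with the product by `g : x ⟶ y`. -/
def ArrowFun.shift {x y : 𝒢} (g : x ⟶ y) : ArrowFun.{w} y →ₗ[ℝ] ArrowFun.{w} x where
  toFun f := f.compContinuous ⟨ArrowsInto.postcomp g, continuous_of_discreteTopology⟩
  map_add' _ _ := rfl
  map_smul' _ _ := rfl

theorem ArrowFun.shift_apply {x y : 𝒢} (g : x ⟶ y) (f : ArrowFun.{w} y) (a : ArrowsInto.{w} x) :
    shift g f a = f (a.postcomp g) := rfl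

theorem ArrowFun.shift_comp {x y z : 𝒢} (g : x ⟶ y) (k : y ⟶ z) (f : ArrowFun.{w} z) :
    shift (g ≫ k) f = shift g (shift k f) := by
  ext a
  simp only [shift_apply, ArrowsInto.postcomp_comp]

theorem ArrowFun.shift_id {x : 𝒢} (f : ArrowFun.{w} x) : shift (𝟙 x) f = f := by
  ext a
  simp only [shift_apply, ArrowsInto.postcomp_id]

/-- An invariant family of sublinear functionals on the bounded functions on the sets of arrows
with given range, each of them dominated by the supremum. -/
structure IsInvariantSublinear (p : ∀ y : 𝒢, ArrowFun.{w} y → ℝ) : Prop where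
  add_le : ∀ y f g, p y (f + g) ≤ p y f + p y g
  smul_le : ∀ y (c : ℝ), 0 < c → ∀ f, p y (c • f) ≤ c * p y f
  le_of_forall_le : ∀ y f C, (∀ a, f a ≤ C) → p y f ≤ C
  shift_le : ∀ {x y : 𝒢} (g : x ⟶ y) f, p x (ArrowFun.shift g f) ≤ p y f

namespace IsInvariantSublinear

variable {p : ∀ y : 𝒢, ArrowFun.{w} y → ℝ}

theorem neg_norm_le (hp : IsInvariantSublinear p) (y : 𝒢) (f : ArrowFun.{w} y) :
    -‖f‖ ≤ p y f := by
  have h0 : 0 ≤ p y 0 := by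
    have := hp.smul_le y 2 two_pos 0
    rw [smul_zero] at this
    linarith
  have h1 := hp.add_le y f (-f)
  rw [add_neg_cancel] at h1
  have h2 := hp.le_of_forall_le y (-f) ‖f‖ fun a => by
    have := (abs_le.1 (f.norm_coe_le_norm a)).1
    rw [BoundedContinuousFunction.neg_apply]
    linarith
  linarith

theorem iSup : IsInvariantSublinear (fun (y : 𝒢) (f : ArrowFun.{w} y) => ⨆ a, f a) := by
  have hb : ∀ (y : 𝒢) (f : ArrowFun.{w} y), BddAbove (Set.range f) := fun y f =>
    ⟨‖f‖, by rintro _ ⟨a, rfl⟩; exact (le_abs_self _).trans (f.norm_coe_le_norm a)⟩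
  refine ⟨fun y f g => ?_, fun y c hc f => ?_, fun y f C h => ciSup_le h, fun {x y} g f => ?_⟩
  · exact ciSup_le fun a => add_le_add (le_ciSup (hb y f) a) (le_ciSup (hb y g) a)
  · exact ciSup_le fun a => mul_le_mul_of_nonneg_left (le_ciSup (hb y f) a) hc.le
  · exact ciSup_le fun a => le_ciSup (hb y f) (a.postcomp g)

theorem exists_minimal : ∃ p : ∀ y : 𝒢, ArrowFun.{w} y → ℝ, IsInvariantSublinear p ∧
    ∀ q, IsInvariantSublinear q → (∀ y f, q y f ≤ p y f) → ∀ y f, p y f = q y f := by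
  have hzorn : ∀ c ⊆ {p : (∀ y : 𝒢, ArrowFun.{w} y → ℝ)ᵒᵈ |
      IsInvariantSublinear (OrderDual.ofDual p)}, IsChain (· ≤ ·) c → ∀ q₀ ∈ c,
      ∃ ub ∈ {p : (∀ y : 𝒢, ArrowFun.{w} y → ℝ)ᵒᵈ | IsInvariantSublinear (OrderDual.ofDual p)},
        ∀ q ∈ c, q ≤ ub := by
    intro c hc hchain q₀ hq₀
    have : Nonempty c := ⟨⟨q₀, hq₀⟩⟩
    let P : ∀ y : 𝒢, ArrowFun.{w} y → ℝ := fun y f => ⨅ q : c, OrderDual.ofDual q.1 y f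
    have hb : ∀ y f, BddBelow (Set.range fun q : c => OrderDual.ofDual q.1 y f) := fun y f =>
      ⟨-‖f‖, by rintro _ ⟨q, rfl⟩; exact (hc q.2).neg_norm_le y f⟩
    have hP : ∀ y f (q : c), P y f ≤ OrderDual.ofDual q.1 y f := fun y f q => ciInf_le (hb y f) q
    refine ⟨OrderDual.toDual P, ⟨fun y f g => ?_, fun y r hr f => ?_, fun y f C h => ?_,
      fun {x y} g f => ?_⟩, fun q hq y f => hP y f ⟨q, hq⟩⟩
    · refine le_ciInf_add_ciInf fun q₁ q₂ => ?_
      -- On a chain, the smaller of two functionals bounds the infimum.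
      rcases hchain.total q₁.2 q₂.2 with h | h
      · exact ((hP y _ q₂).trans ((hc q₂.2).add_le y f g)).trans (add_le_add_left (h y f) _)
      · exact ((hP y _ q₁).trans ((hc q₁.2).add_le y f g)).trans (add_le_add_right (h y g) _)
    · rw [← inv_mul_le_iff₀ hr]
      refine le_ciInf fun q => ?_
      rw [inv_mul_le_iff₀ hr]
      exact (hP y _ q).trans ((hc q.2).smul_le y r hr f)
    · exact (hP y f ⟨q₀, hq₀⟩).trans ((hc hq₀).le_of_forall_le y f C h)
    · exact le_ciInf fun q => (hP x _ q).trans ((hc q.2).shift_le g f)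
  obtain ⟨p, -, hp⟩ := zorn_le_nonempty₀ _ hzorn (OrderDual.toDual _) (iSup (𝒢 := 𝒢))
  refine ⟨OrderDual.ofDual p, hp.prop, fun q hq hqp y f => ?_⟩
  have hle : p ≤ OrderDual.toDual q := hqp
  exact (hp.le_of_ge hq hle y f).antisymm (hqp y f)

/-- The linear functionals dominated by `p`. -/
def dominated (p : ∀ y : 𝒢, ArrowFun.{w} y → ℝ) (y : 𝒢) : Set (ArrowFun.{w} y → ℝ) :=
  {s | (∀ f g, s (f + g) = s f + s g) ∧ (∀ (c : ℝ) f, s (c • f) = c * s f) ∧ ∀ f, s f ≤ p y f}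

/-- An element of `dominated p y`, as a linear map. -/
def linearMapOfMem {y : 𝒢} {s : ArrowFun.{w} y → ℝ} (hs : s ∈ dominated p y) :
    ArrowFun.{w} y →ₗ[ℝ] ℝ where
  toFun := s
  map_add' := hs.1
  map_smul' := hs.2.1

theorem mem_dominated {y : 𝒢} (s : ArrowFun.{w} y →ₗ[ℝ] ℝ) (hs : ∀ f, s f ≤ p y f) :
    ⇑s ∈ dominated p y := ⟨s.map_add, s.map_smul, hs⟩

theorem isClosed_dominated (y : 𝒢) : IsClosed (dominated p y) := by
  simp only [dominated, Set.ofPred_and, Set.ofPred_forall]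
  refine IsClosed.inter ?_ (IsClosed.inter ?_ ?_)
  · exact isClosed_iInter fun f => isClosed_iInter fun g => isClosed_eq (by fun_prop) (by fun_prop)
  · exact isClosed_iInter fun c => isClosed_iInter fun f => isClosed_eq (by fun_prop) (by fun_prop)
  · exact isClosed_iInter fun f => isClosed_le (by fun_prop) (by fun_prop)

theorem isCompact_dominated (y : 𝒢) : IsCompact (dominated p y) := by
  refine (isCompact_univ_pi fun f => isCompact_Icc (a := -p y (-f)) (b := p y f)).of_isClosed_subset
    (isClosed_dominated y) fun s hs f _ => ⟨?_, hs.2.2 f⟩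
  have h1 := (linearMapOfMem hs).map_neg f
  have h2 := hs.2.2 (-f)
  change s (-f) = -s f at h1
  linarith

theorem nonempty_dominated (hp : IsInvariantSublinear p) (y : 𝒢) : (dominated p y).Nonempty := by
  obtain ⟨t, ht, -⟩ := exists_linear_le_eq (p y) (hp.smul_le y) (hp.add_le y) 0
  exact ⟨t, mem_dominated t ht⟩

theorem nonempty_extremePoints (hp : IsInvariantSublinear p) (y : 𝒢) :
    ((dominated p y).extremePoints ℝ).Nonempty :=
  (isCompact_dominated y).extremePoints_nonempty (hp.nonempty_dominated y)

theorem closure_extremePoints_subset (y : 𝒢) :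
    closure ((dominated p y).extremePoints ℝ) ⊆ dominated p y :=
  closure_minimal extremePoints_subset (isClosed_dominated y)

/-- The action of an arrow on functionals. -/
def transport {x y : 𝒢} (g : x ⟶ y) : (ArrowFun.{w} x → ℝ) ≃L[ℝ] (ArrowFun.{w} y → ℝ) where
  toFun s f := s (ArrowFun.shift g f)
  invFun s f := s (ArrowFun.shift (Groupoid.inv g) f)
  map_add' _ _ := rfl
  map_smul' _ _ := rfl
  left_inv s := by
    ext f
    simp only [← ArrowFun.shift_comp, Groupoid.comp_inv, ArrowFun.shift_id]
  right_inv s := by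
    ext f
    simp only [← ArrowFun.shift_comp, Groupoid.inv_comp, ArrowFun.shift_id]
  continuous_toFun := by fun_prop
  continuous_invFun := by fun_prop

theorem transport_apply {x y : 𝒢} (g : x ⟶ y) (s : ArrowFun.{w} x → ℝ) (f : ArrowFun.{w} y) :
    transport g s f = s (ArrowFun.shift g f) := rfl

theorem transport_mem (hp : IsInvariantSublinear p) {x y : 𝒢} (g : x ⟶ y)
    {s : ArrowFun.{w} x → ℝ} (hs : s ∈ dominated p x) : transport g s ∈ dominated p y := by
  refine ⟨fun f k => ?_, fun c f => ?_, fun f => ?_⟩ <;>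
    simp only [transport_apply, map_add, map_smul]
  · exact hs.1 _ _
  · exact hs.2.1 _ _
  · exact (hs.2.2 _).trans (hp.shift_le g f)

theorem transport_image (hp : IsInvariantSublinear p) {x y : 𝒢} (g : x ⟶ y) :
    transport g '' dominated p x = dominated p y := by
  refine Set.Subset.antisymm ?_ fun s hs => ?_
  · rintro _ ⟨s, hs, rfl⟩
    exact hp.transport_mem g hs
  · exact ⟨_, hp.transport_mem (Groupoid.inv g) hs, (transport g).apply_symm_apply s⟩

theorem transport_image_closure (hp : IsInvariantSublinear p) {x y : 𝒢} (g : x ⟶ y) :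
    transport g '' closure ((dominated p x).extremePoints ℝ) =
      closure ((dominated p y).extremePoints ℝ) := by
  rw [← hp.transport_image g, ← image_extremePoints]
  exact (transport g).toHomeomorph.image_closure _

/-- The closures of the sets of extreme points of the sets of functionals dominated by `p`, as a
compact space with a groupoid action. -/
def extremeSpace (hp : IsInvariantSublinear p) : GSpace.{max u v w} 𝒢 where
  fibre y := closure ((dominated p y).extremePoints ℝ)
  compact y := isCompact_iff_compactSpace.1
    ((isCompact_dominated y).of_isClosed_subset isClosed_closure (closure_extremePoints_subset y))
  nonempty y := (hp.nonempty_extremePoints y).closure.to_subtype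
  act g := (transport g).toHomeomorph.sets (by
    rw [← hp.transport_image_closure g]
    exact ((transport g).injective.preimage_image _).symm)
  act_id x s := Subtype.ext (funext fun f => congrArg s.1 (ArrowFun.shift_id f))
  act_mul h g s := Subtype.ext (funext fun f => congrArg s.1 (ArrowFun.shift_comp h g f))

end IsInvariantSublinear

/-! ### The space of extreme points is a boundary -/

namespace IsInvariantSublinear

variable {p : ∀ y : 𝒢, ArrowFun.{w} y → ℝ} (hp : IsInvariantSublinear p)

theorem mem_dominated_of_fibre {y : 𝒢} (s : hp.extremeSpace.fibre y) : s.1 ∈ dominated p y :=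
  closure_extremePoints_subset y s.2

/-- The values of a bounded function at the points of `extremeSpace`, which are functionals, along
a continuous map into this space. -/
def coord {T : Type*} [TopologicalSpace T] {y : 𝒢} (ι : C(T, hp.extremeSpace.fibre y)) :
    ArrowFun.{w} y →ₗ[ℝ] C(T, ℝ) where
  toFun f := ⟨fun t => (ι t).1 f,
    (continuous_apply f).comp (continuous_subtype_val.comp ι.continuous)⟩
  map_add' f g := ContinuousMap.ext fun t => (hp.mem_dominated_of_fibre (ι t)).1 f g
  map_smul' c f := ContinuousMap.ext fun t => (hp.mem_dominated_of_fibre (ι t)).2.1 c f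

@[simp] theorem coord_apply {T : Type*} [TopologicalSpace T] {y : 𝒢}
    (ι : C(T, hp.extremeSpace.fibre y)) (f : ArrowFun.{w} y) (t : T) :
    hp.coord ι f t = (ι t).1 f := rfl

theorem apply_le_of_forall_le {y : 𝒢} (s : hp.extremeSpace.fibre y) (f : ArrowFun.{w} y) {C : ℝ}
    (h : ∀ a, f a ≤ C) : s.1 f ≤ C :=
  ((hp.mem_dominated_of_fibre s).2.2 f).trans (hp.le_of_forall_le y f C h)

theorem apply_one {y : 𝒢} (s : hp.extremeSpace.fibre y) : s.1 1 = 1 := by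
  have h1 := hp.apply_le_of_forall_le s 1 (C := 1) fun a => le_rfl
  have h2 := hp.apply_le_of_forall_le s (-1) (C := -1) fun a => le_rfl
  have h3 := (linearMapOfMem (hp.mem_dominated_of_fibre s)).map_neg 1
  change s.1 (-1) = -s.1 1 at h3
  linarith

theorem exists_le_coord_and_apply_lt {T : Type*} [TopologicalSpace T] [CompactSpace T] {y : 𝒢}
    (ι : C(T, hp.extremeSpace.fibre y)) (hT : ∀ f C, (∀ t, (ι t).1 f ≤ C) → p y f ≤ C)
    {e : ArrowFun.{w} y → ℝ} (he : e ∈ (dominated p y).extremePoints ℝ)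
    {F : C(T, ℝ)} (hF : 0 ≤ F) (hFe : ∀ t, (ι t).1 = e → F t = 0) {ε : ℝ} (hε : 0 < ε) :
    ∃ h, F ≤ hp.coord ι h ∧ e h < ε := by
  refine exists_le_ev_and_apply_lt (p := p y) (i := 1) (e := linearMapOfMem he.1) ?_ ?_ hT
    he.1.2.2 ?_ hF (fun t ht => hFe t (funext ht)) hε
  · ext t
    exact hp.apply_one _
  · exact fun f t => (hp.mem_dominated_of_fibre (ι t)).2.2 f
  · intro s₁ s₂ c hc0 hc1 hs₁ hs₂ h
    refine DFunLike.coe_injective (he.2 (mem_dominated s₁ hs₁) (mem_dominated s₂ hs₂)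
      ⟨c, 1 - c, hc0, sub_pos.2 hc1, by ring, ?_⟩)
    exact congrArg DFunLike.coe h

variable {hp}

/-- If `p` is minimal, then so is `extremeSpace`: the suprema over a closed invariant subfamily
form an invariant sublinear family, which is `p`, so that the subfamily contains all extreme
points. -/
theorem isMinimal_extremeSpace
    (hmin : ∀ q, IsInvariantSublinear q → (∀ y f, q y f ≤ p y f) → ∀ y f, p y f = q y f) :
    hp.extremeSpace.IsMinimal := by
  intro Y hYc hYn hYi y
  have hYn' : ∀ y, Nonempty (Y y) := fun y => (hYn y).to_subtype
  let q : ∀ y : 𝒢, ArrowFun.{w} y → ℝ := fun y f => ⨆ s : Y y, s.1.1 f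
  have hsp : ∀ (y : 𝒢) (s : Y y) f, s.1.1 f ≤ p y f := fun y s f =>
    (hp.mem_dominated_of_fibre s.1).2.2 f
  have hb : ∀ (y : 𝒢) f, BddAbove (Set.range fun s : Y y => s.1.1 f) := fun y f =>
    ⟨p y f, by rintro _ ⟨s, rfl⟩; exact hsp y s f⟩
  have hq : IsInvariantSublinear q := by
    refine ⟨fun y f g => ciSup_le fun s => ?_, fun y c hc f => ciSup_le fun s => ?_,
      fun y f C h => ciSup_le fun s => hp.apply_le_of_forall_le s.1 f h,
      fun {x y} g f => ciSup_le fun s => ?_⟩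
    · rw [(hp.mem_dominated_of_fibre s.1).1]
      exact add_le_add (le_ciSup (hb y f) s) (le_ciSup (hb y g) s)
    · rw [(hp.mem_dominated_of_fibre s.1).2.1]
      exact mul_le_mul_of_nonneg_left (le_ciSup (hb y f) s) hc.le
    · exact le_ciSup (hb y f)
        ⟨hp.extremeSpace.act g s.1, (hYi g).le (Set.mem_image_of_mem _ s.2)⟩
  have hpq := hmin q hq fun y f => ciSup_le fun s => hsp y s f
  have : CompactSpace (Y y) := isCompact_iff_compactSpace.1 (hYc y).isCompact
  have hT : ∀ f C, (∀ s : Y y, s.1.1 f ≤ C) → p y f ≤ C := fun f C h =>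
    (hpq y f).trans_le (ciSup_le h)
  have hmem : (dominated p y).extremePoints ℝ ⊆ Subtype.val '' Y y := by
    intro e he
    by_contra hne
    obtain ⟨h, h1, h2⟩ := hp.exists_le_coord_and_apply_lt (T := Y y) ⟨_, continuous_subtype_val⟩ hT
      he (F := 1) zero_le_one (fun s hs => (hne ⟨s.1, s.2, hs⟩).elim) one_pos
    have h3 : p y (-h) ≤ -1 := hT _ _ fun s => by
      have h3 : (1 : ℝ) ≤ s.1.1 h := h1 s
      have h4 : s.1.1 (-h) = -s.1.1 h :=
        (linearMapOfMem (hp.mem_dominated_of_fibre s.1)).map_neg h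
      linarith
    have h4 : e (-h) = -e h := (linearMapOfMem he.1).map_neg h
    have h5 := he.1.2.2 (-h)
    linarith
  have hclosed : IsClosed (Subtype.val '' Y y) :=
    ((hYc y).isCompact.image continuous_subtype_val).isClosed
  refine Set.eq_univ_of_forall fun s => ?_
  obtain ⟨s', hs', h⟩ := closure_minimal hmem hclosed s.2
  rwa [← Subtype.ext h]

/-- If `p` is minimal, then `extremeSpace` is strongly proximal: the suprema over the orbit of a
state form an invariant sublinear family, which is `p`; hence the translates of the state
accumulate at the point masses of extreme points. -/
theorem isStateProximal_extremeSpace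
    (hmin : ∀ q, IsInvariantSublinear q → (∀ y f, q y f ≤ p y f) → ∀ y f, p y f = q y f) :
    hp.extremeSpace.IsStateProximal := by
  classical
  intro x y hxy s hs
  let c : ∀ z : 𝒢, ArrowFun.{w} z →ₗ[ℝ] C(hp.extremeSpace.fibre z, ℝ) := fun z =>
    hp.coord (ContinuousMap.id _)
  have hmono : ∀ f g : C(hp.extremeSpace.fibre x, ℝ), f ≤ g → s f ≤ s g := fun _ _ => hs.mono
  have hle : ∀ f C, (∀ t, f t ≤ C) → s f ≤ C := fun f C h => by
    have := hmono f (C • 1) fun t => by simpa using h t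
    rwa [map_smul, hs.map_one, smul_eq_mul, mul_one] at this
  let φ : ∀ {z : 𝒢}, (x ⟶ z) → ArrowFun.{w} z →ₗ[ℝ] ℝ := fun {z} g =>
    s ∘ₗ hp.extremeSpace.compAct g ∘ₗ c z
  have hφp : ∀ {z : 𝒢} (g : x ⟶ z) f, φ g f ≤ p z f := fun g f =>
    hle _ _ fun t => (hp.mem_dominated_of_fibre (hp.extremeSpace.act g t)).2.2 f
  have hb : ∀ (z : 𝒢) f, BddAbove (Set.range fun g : x ⟶ z => φ g f) := fun z f =>
    ⟨p z f, by rintro _ ⟨g, rfl⟩; exact hφp g f⟩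
  have hφc : ∀ {z z' : 𝒢} (g : x ⟶ z) (k : z ⟶ z') f, φ g (ArrowFun.shift k f) = φ (g ≫ k) f :=
    fun {z z'} g k f => by
      refine congrArg s (ContinuousMap.ext fun t => ?_)
      change _ = (hp.extremeSpace.act (g ≫ k) t).1 f
      rw [hp.extremeSpace.act_mul]
      rfl
  -- Over the units that cannot be reached from `x`, the functional `p z` is left unchanged.
  let q : ∀ z : 𝒢, ArrowFun.{w} z → ℝ := fun z f =>
    if Nonempty (x ⟶ z) then ⨆ g : x ⟶ z, φ g f else p z f
  have hq1 : ∀ {z : 𝒢}, Nonempty (x ⟶ z) → ∀ f, q z f = ⨆ g : x ⟶ z, φ g f := fun h f => if_pos h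
  have hq2 : ∀ {z : 𝒢}, ¬ Nonempty (x ⟶ z) → ∀ f, q z f = p z f := fun h f => if_neg h
  have hqp : ∀ z f, q z f ≤ p z f := fun z f => by
    by_cases h : Nonempty (x ⟶ z)
    · rw [hq1 h]
      exact ciSup_le fun g => hφp g f
    · exact (hq2 h f).le
  have hq : IsInvariantSublinear q := by
    refine ⟨fun z f f' => ?_, fun z r hr f => ?_, fun z f C h =>
      (hqp z f).trans (hp.le_of_forall_le z f C h), fun {z z'} k f => ?_⟩
    · by_cases h : Nonempty (x ⟶ z)
      · simp only [hq1 h]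
        refine ciSup_le fun g => ?_
        rw [map_add]
        exact add_le_add (le_ciSup (hb z f) g) (le_ciSup (hb z f') g)
      · simp only [hq2 h]
        exact hp.add_le z f f'
    · by_cases h : Nonempty (x ⟶ z)
      · simp only [hq1 h]
        refine ciSup_le fun g => ?_
        rw [map_smul]
        exact mul_le_mul_of_nonneg_left (le_ciSup (hb z f) g) hr.le
      · simp only [hq2 h]
        exact hp.smul_le z r hr f
    · by_cases h : Nonempty (x ⟶ z)
      · rw [hq1 h, hq1 (h.map fun g => g ≫ k)]
        refine ciSup_le fun g => ?_
        rw [hφc]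
        exact le_ciSup (hb z' f) (g ≫ k)
      · have h' : ¬ Nonempty (x ⟶ z') := fun h' => h (h'.map fun g => g ≫ Groupoid.inv k)
        rw [hq2 h, hq2 h']
        exact hp.shift_le k f
  have hT : ∀ f C, (∀ g : x ⟶ y, φ g f ≤ C) → p y f ≤ C := fun f C h => by
    rw [hmin q hq hqp, hq1 hxy]
    exact ciSup_le h
  obtain ⟨e, he⟩ := hp.nonempty_extremePoints y
  refine ⟨⟨e, subset_closure he⟩, fun F hF hFe ε hε => ?_⟩
  obtain ⟨h, h1, h2⟩ := hp.exists_le_coord_and_apply_lt (ContinuousMap.id _)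
    (fun f C h => hT f C fun g => hle _ _ fun t => h (hp.extremeSpace.act g t)) he hF
    (fun t ht => by rw [← hFe]; exact congrArg F (Subtype.ext ht)) hε
  by_contra! hge
  have h3 : p y (-h) ≤ -ε := hT _ _ fun g => by
    rw [map_neg]
    have h4 : s (hp.extremeSpace.compAct g F) ≤ φ g h := hmono _ _ fun t =>
      h1 (hp.extremeSpace.act g t)
    have := hge g
    linarith
  have h4 : e (-h) = -e h := (linearMapOfMem he.1).map_neg h
  have h5 := he.1.2.2 (-h)
  linarith

theorem isBoundary_extremeSpace
    (hmin : ∀ q, IsInvariantSublinear q → (∀ y f, q y f ≤ p y f) → ∀ y f, p y f = q y f) :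
    hp.extremeSpace.IsBoundary :=
  GSpace.isBoundary_iff.2 ⟨isMinimal_extremeSpace hmin, isStateProximal_extremeSpace hmin⟩

end IsInvariantSublinear

/-! ### Positivity in C*-algebras -/

section Positivity

theorem exists_eq_star_mul_self {A : Type*} [CStarAlgebra A] {a : A} (ha : IsSelfAdjoint a)
    (h : ∀ r ∈ spectrum ℝ a, 0 ≤ r) : ∃ d : A, a = star d * d := by
  let _ := CStarAlgebra.spectralOrder A
  have := CStarAlgebra.spectralOrderedRing A
  refine CStarAlgebra.nonneg_iff_eq_star_mul_self.1 ?_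
  exact nonneg_iff_isSelfAdjoint_and_quasispectrumRestricts.2
    ⟨ha, quasispectrumRestricts_iff_spectrumRestricts.2 (SpectrumRestricts.nnreal_iff.2 h)⟩

theorem exists_sum_eq_star_mul_self {A ι : Type*} [CStarAlgebra A] (s : Finset ι) (d : ι → A) :
    ∃ b : A, ∑ i ∈ s, star (d i) * d i = star b * b := by
  let _ := CStarAlgebra.spectralOrder A
  have := CStarAlgebra.spectralOrderedRing A
  exact CStarAlgebra.nonneg_iff_eq_star_mul_self.1
    (Finset.sum_nonneg fun i _ => star_mul_self_nonneg (d i))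

theorem exists_norm_smul_sub_eq_star_mul_self {A : Type*} [CStarAlgebra A] {a : A}
    (ha : IsSelfAdjoint a) : ∃ b : A, (‖a‖ : ℂ) • 1 - a = star b * b := by
  let _ := CStarAlgebra.spectralOrder A
  have := CStarAlgebra.spectralOrderedRing A
  refine CStarAlgebra.nonneg_iff_eq_star_mul_self.1 ?_
  have h := ha.le_algebraMap_norm_self
  rw [Algebra.algebraMap_eq_smul_one] at h
  exact sub_nonneg.2 h

/-- A matrix of continuous functions that is positive semidefinite at every point is positive: its
spectrum is nonnegative, since a matrix of continuous functions is invertible if its determinant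
has no zero. -/
theorem exists_eq_conjTranspose_mul_self {K : Type*} [TopologicalSpace K] [CompactSpace K] {n : ℕ}
    (B : Matrix (Fin n) (Fin n) C(K, ℂ)) (hB : Bᴴ = B)
    (hpos : ∀ (k : K) (c : Fin n → ℂ), 0 ≤ (∑ i, ∑ j, star (c i) * c j * B i j k).re) :
    ∃ N : Matrix (Fin n) (Fin n) C(K, ℂ), B = Nᴴ * N := by
  let _ := CStarAlgebra.spectralOrder C(K, ℂ)
  have := CStarAlgebra.spectralOrderedRing C(K, ℂ)
  obtain ⟨N, hN⟩ := exists_eq_star_mul_self (a := CStarMatrix.ofMatrix B) hB fun r hr => by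
    by_contra! hr0
    refine hr ?_
    have hunit : IsUnit ((algebraMap ℂ (Matrix (Fin n) (Fin n) C(K, ℂ)) r) - B) := by
      rw [Matrix.isUnit_iff_isUnit_det, ContinuousMap.isUnit_iff_forall_ne_zero]
      intro k hk
      have hdet : (((algebraMap ℂ (Matrix (Fin n) (Fin n) C(K, ℂ)) r) - B).map
          (ContinuousMap.evalAlgHom ℂ ℂ k)).det = 0 := by
        rw [← hk]
        exact (AlgHom.map_det (ContinuousMap.evalAlgHom ℂ ℂ k) _).symm
      obtain ⟨c, hc0, hc⟩ := Matrix.exists_mulVec_eq_zero_iff.2 hdet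
      have hentry : ∀ i, ∑ j, B i j k * c j = r * c i := fun i => by
        have h1 := congrFun hc i
        simp only [Matrix.mulVec, dotProduct, Matrix.map_apply, Matrix.sub_apply, map_sub,
          Pi.zero_apply, sub_mul, Finset.sum_sub_distrib, sub_eq_zero] at h1
        refine (Eq.trans ?_ h1).symm
        rw [Finset.sum_eq_single i]
        · simp [Matrix.algebraMap_matrix_apply]
        · intro j _ hj
          simp [Matrix.algebraMap_matrix_apply, hj.symm]
        · simp
      have h1 := hpos k c
      have h2 : ∑ i, ∑ j, star (c i) * c j * B i j k = ((r * ∑ i, ‖c i‖ ^ 2 : ℝ) : ℂ) := by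
        push_cast
        rw [Finset.mul_sum]
        refine Finset.sum_congr rfl fun i _ => ?_
        rw [← Complex.conj_mul', mul_left_comm, ← hentry, Finset.mul_sum]
        refine Finset.sum_congr rfl fun j _ => ?_
        simp only [RCLike.star_def]
        ring
      rw [h2, Complex.ofReal_re] at h1
      have h3 : 0 < ∑ i, ‖c i‖ ^ 2 := by
        obtain ⟨i, hi⟩ := Function.ne_iff.1 hc0
        refine Finset.sum_pos' (fun _ _ => by positivity) ⟨i, Finset.mem_univ i, ?_⟩
        have := norm_pos_iff.2 hi
        positivity
      nlinarith
    exact hunit.map CStarMatrix.ofMatrixRingEquiv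
  exact ⟨CStarMatrix.ofMatrix.symm N, congrArg CStarMatrix.ofMatrix.symm hN⟩

end Positivity

/-! ### Positive functionals on operator systems -/

namespace OperatorSystem

variable {S T : OperatorSystem.{w}}

/-- An element of an operator system is positive if it is a positive element of the ambient
C*-algebra. -/
def IsPositive (S : OperatorSystem.{w}) (a : S.Elt) : Prop :=
  ∃ d : S.Ambient, (a : S.Ambient) = star d * d

theorem matrixPositive_one_iff {a : S.Elt} :
    S.MatrixPositive (Matrix.of fun _ _ : Fin 1 => a) ↔ S.IsPositive a := by
  constructor
  · rintro ⟨N, hN⟩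
    refine ⟨N 0 0, (congrFun (congrFun hN 0) 0).trans ?_⟩
    simp [Matrix.mul_apply]
  · rintro ⟨d, hd⟩
    refine ⟨Matrix.of fun _ _ => d, ?_⟩
    ext i j
    simpa [Matrix.mul_apply] using hd

theorem IsUCP.isPositive {φ : S.Elt →ₗ[ℂ] T.Elt} (hφ : IsUCP φ) {a : S.Elt}
    (ha : S.IsPositive a) : T.IsPositive (φ a) :=
  matrixPositive_one_iff.1 (hφ.2 1 _ (matrixPositive_one_iff.2 ha))

theorem IsCompleteOrderEmbedding.isPositive_iff {φ : S.Elt →ₗ[ℂ] T.Elt}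
    (hφ : IsCompleteOrderEmbedding φ) {a : S.Elt} : S.IsPositive a ↔ T.IsPositive (φ a) :=
  matrixPositive_one_iff.symm.trans
    ((hφ.2 1 _).trans (matrixPositive_one_iff (S := T) (a := φ a)))

theorem IsCompleteOrderEmbedding.isUCP {φ : S.Elt →ₗ[ℂ] T.Elt}
    (hφ : IsCompleteOrderEmbedding φ) : IsUCP φ :=
  ⟨hφ.1, fun n M hM => (hφ.2 n M).1 hM⟩

/-- The adjoint of an element of an operator system. -/
def adjoint (a : S.Elt) : S.Elt := ⟨star (a : S.Ambient), S.star_mem _ a.2⟩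

theorem IsPositive.adjoint_eq {a : S.Elt} (ha : S.IsPositive a) : adjoint a = a := by
  obtain ⟨d, hd⟩ := ha
  refine Subtype.ext ?_
  change star (a : S.Ambient) = a
  rw [hd, star_mul, star_star]

theorem IsPositive.add {a b : S.Elt} (ha : S.IsPositive a) (hb : S.IsPositive b) :
    S.IsPositive (a + b) := by
  obtain ⟨d, hd⟩ := ha
  obtain ⟨d', hd'⟩ := hb
  obtain ⟨c, hc⟩ := exists_sum_eq_star_mul_self Finset.univ ![d, d']
  refine ⟨c, hc ▸ ?_⟩
  change (a : S.Ambient) + b = _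
  simp [hd, hd', Fin.sum_univ_two]

theorem IsPositive.smul {a : S.Elt} (ha : S.IsPositive a) {r : ℝ} (hr : 0 ≤ r) :
    S.IsPositive (r • a) := by
  obtain ⟨d, hd⟩ := ha
  refine ⟨Real.sqrt r • d, ?_⟩
  change r • (a : S.Ambient) = _
  rw [hd, star_smul, star_trivial (Real.sqrt r), smul_mul_smul_comm, Real.mul_self_sqrt hr]

theorem isPositive_zero : S.IsPositive 0 := ⟨0, by simp⟩

theorem isPositive_unit : S.IsPositive S.unit := ⟨1, by simp [unit]⟩

theorem exists_isPositive_smul_unit_sub {a : S.Elt} (ha : adjoint a = a) :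
    ∃ r : ℝ, S.IsPositive (r • S.unit - a) := by
  obtain ⟨b, hb⟩ := exists_norm_smul_sub_eq_star_mul_self
    (show IsSelfAdjoint (a : S.Ambient) from congrArg Subtype.val ha)
  exact ⟨‖(a : S.Ambient)‖, b, hb⟩

/-- The real part of an element of an operator system. -/
def realPart : S.Elt →ₗ[ℝ] S.Elt where
  toFun a := (1 / 2 : ℝ) • (a + adjoint a)
  map_add' a b := by
    have : adjoint (a + b) = adjoint a + adjoint b := Subtype.ext (star_add _ _)
    rw [this, ← smul_add]
    congr 1
    abel
  map_smul' r a := by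
    have : adjoint (r • a) = r • adjoint a := Subtype.ext (by
      change star (r • (a : S.Ambient)) = r • star (a : S.Ambient)
      rw [star_smul, star_trivial])
    rw [this, ← smul_add, smul_comm]
    rfl

theorem realPart_apply (a : S.Elt) : realPart a = (1 / 2 : ℝ) • (a + adjoint a) := rfl

theorem adjoint_realPart (a : S.Elt) : adjoint (realPart a) = realPart a := Subtype.ext (by
  change star ((1 / 2 : ℝ) • ((a : S.Ambient) + star (a : S.Ambient))) =
    (1 / 2 : ℝ) • ((a : S.Ambient) + star (a : S.Ambient))
  rw [star_smul, star_trivial, star_add, star_star, add_comm])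

theorem realPart_of_adjoint_eq {a : S.Elt} (ha : adjoint a = a) : realPart a = a := by
  rw [realPart_apply, ha, ← two_smul ℝ, smul_smul]
  norm_num

theorem realPart_I_smul_of_adjoint_eq {a : S.Elt} (ha : adjoint a = a) :
    realPart (Complex.I • a) = 0 := by
  have : adjoint (Complex.I • a) = -(Complex.I • adjoint a) := Subtype.ext (by
    change star (Complex.I • (a : S.Ambient)) = -(Complex.I • star (a : S.Ambient))
    rw [star_smul]
    simp)
  rw [realPart_apply, this, ha, add_neg_cancel, smul_zero]

theorem eq_realPart_add (a : S.Elt) :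
    a = realPart a + Complex.I • realPart (-(Complex.I • a)) := by
  refine Subtype.ext ?_
  change (a : S.Ambient) = (1 / 2 : ℝ) • ((a : S.Ambient) + star (a : S.Ambient)) +
    Complex.I • ((1 / 2 : ℝ) • (-(Complex.I • (a : S.Ambient)) +
      star (-(Complex.I • (a : S.Ambient)))))
  simp only [star_neg, star_smul, smul_add, smul_neg, smul_comm Complex.I (1 / 2 : ℝ), smul_smul,
    RCLike.star_def, Complex.conj_I, neg_smul, neg_neg, Complex.I_mul_I, one_smul]
  have : (a : S.Ambient) = (1 / 2 : ℝ) • (a : S.Ambient) + (1 / 2 : ℝ) • (a : S.Ambient) := by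
    rw [← add_smul]
    norm_num
  nth_rewrite 1 [this]
  abel_nf

/-- A linear map with self-adjoint values on the positive elements commutes with the adjoint. -/
theorem map_realPart {E : Type*} [AddCommGroup E] [Module ℂ E] [StarAddMonoid E] [StarModule ℂ E]
    (φ : S.Elt →ₗ[ℂ] E) (h : ∀ a, S.IsPositive a → star (φ a) = φ a) (a : S.Elt) :
    star (φ (realPart a)) = φ (realPart a) := by
  obtain ⟨r, hr⟩ := exists_isPositive_smul_unit_sub (adjoint_realPart a)
  have h1 : φ (realPart a) = (r : ℂ) • φ S.unit - φ (r • S.unit - realPart a) := by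
    rw [map_sub, ← Complex.coe_smul, map_smul, sub_sub_cancel]
  rw [h1, star_sub, star_smul, h _ hr, h _ isPositive_unit]
  simp

theorem realPart_map {φ : S.Elt →ₗ[ℂ] T.Elt} (h : ∀ a, S.IsPositive a → T.IsPositive (φ a))
    (a : S.Elt) : realPart (φ a) = φ (realPart a) := by
  have h1 : ∀ a, adjoint (φ (realPart a)) = φ (realPart a) := fun a => Subtype.ext
    (map_realPart (T.carrier.subtype ∘ₗ φ)
      (fun a ha => congrArg Subtype.val (h a ha).adjoint_eq) a)
  conv_lhs => rw [eq_realPart_add a, map_add, map_smul, map_add, realPart_of_adjoint_eq (h1 a),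
    realPart_I_smul_of_adjoint_eq (h1 _), add_zero]

/-- Positive unital functionals on an operator system. -/
structure IsUnitalPositive (σ : S.Elt →ₗ[ℂ] ℂ) : Prop where
  map_unit : σ S.unit = 1
  re_nonneg : ∀ a, S.IsPositive a → 0 ≤ (σ a).re
  im_eq_zero : ∀ a, S.IsPositive a → (σ a).im = 0

theorem IsUnitalPositive.im_realPart {σ : S.Elt →ₗ[ℂ] ℂ} (hσ : IsUnitalPositive σ) (a : S.Elt) :
    (σ (realPart a)).im = 0 :=
  Complex.conj_eq_iff_im.1
    (map_realPart σ (fun a ha => Complex.conj_eq_iff_im.2 (hσ.im_eq_zero a ha)) a)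

theorem IsUnitalPositive.re_realPart {σ : S.Elt →ₗ[ℂ] ℂ} (hσ : IsUnitalPositive σ) (a : S.Elt) :
    (σ (realPart a)).re = (σ a).re := by
  conv_rhs => rw [eq_realPart_add a, map_add, map_smul]
  simp [hσ.im_realPart]

theorem IsUnitalPositive.map_adjoint {σ : S.Elt →ₗ[ℂ] ℂ} (hσ : IsUnitalPositive σ) (a : S.Elt) :
    σ (adjoint a) = star (σ a) := by
  have h1 : ∀ a : S.Elt, (σ (adjoint a)).re = (σ a).re := fun a => by
    have : realPart (adjoint a) = realPart a := by
      have h : adjoint (adjoint a) = a := Subtype.ext (star_star _)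
      rw [realPart_apply, realPart_apply, h, add_comm]
    rw [← hσ.re_realPart, this, hσ.re_realPart]
  refine Complex.ext (h1 a) ?_
  have h2 : adjoint (Complex.I • a) = -(Complex.I • adjoint a) := Subtype.ext (by
    change star (Complex.I • (a : S.Ambient)) = -(Complex.I • star (a : S.Ambient))
    rw [star_smul]
    simp)
  have h3 := h1 (Complex.I • a)
  rw [h2, map_neg, map_smul, map_smul] at h3
  simpa using h3

theorem IsUnitalPositive.comp {φ : S.Elt →ₗ[ℂ] T.Elt} (hφ : IsUCP φ) {σ : T.Elt →ₗ[ℂ] ℂ}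
    (hσ : IsUnitalPositive σ) : IsUnitalPositive (σ ∘ₗ φ) where
  map_unit := by rw [LinearMap.comp_apply, hφ.1, hσ.map_unit]
  re_nonneg a ha := hσ.re_nonneg _ (hφ.isPositive ha)
  im_eq_zero a ha := hσ.im_eq_zero _ (hφ.isPositive ha)

/-- The complex functional with real part `t` is positive and unital if `t` is nonnegative on the
real parts of positive elements, with value `1` at the unit. -/
theorem isUnitalPositive_extendRCLike {t : S.Elt →ₗ[ℝ] ℝ} (ht1 : t S.unit = 1)
    (ht : ∀ a, S.IsPositive (realPart a) → 0 ≤ t a) :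
    IsUnitalPositive (Module.Dual.extendRCLike (𝕜 := ℂ) t) := by
  have hI : ∀ a, S.IsPositive a → t (Complex.I • a) = 0 := fun a ha => by
    have h0 := realPart_I_smul_of_adjoint_eq ha.adjoint_eq
    have h1 := ht (Complex.I • a) (h0 ▸ isPositive_zero)
    have h2 := ht (-(Complex.I • a)) (by rw [map_neg, h0, neg_zero]; exact isPositive_zero)
    rw [map_neg] at h2
    linarith
  have hre : ∀ a, (Module.Dual.extendRCLike (𝕜 := ℂ) t a).re = t a := fun a =>
    Module.Dual.re_extendRCLike_apply (𝕜 := ℂ) t a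
  have him : ∀ a, (Module.Dual.extendRCLike (𝕜 := ℂ) t a).im = -t (Complex.I • a) := fun a =>
    Module.Dual.im_extendRCLike_apply (𝕜 := ℂ) t a
  refine ⟨Complex.ext ?_ ?_, fun a ha => ?_, fun a ha => ?_⟩
  · rw [hre, ht1, Complex.one_re]
  · rw [him, hI _ isPositive_unit, neg_zero, Complex.one_im]
  · rw [hre]
    exact ht a (by rwa [realPart_of_adjoint_eq ha.adjoint_eq])
  · rw [him, hI a ha, neg_zero]

/-- States extend along complete order embeddings: the Hahn–Banach theorem is applied to the
infimum of the values of the state at the elements of `S` above a given element of `T`. -/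
theorem IsUnitalPositive.exists_extension {φ : S.Elt →ₗ[ℂ] T.Elt}
    (hφ : IsCompleteOrderEmbedding φ) {σ : S.Elt →ₗ[ℂ] ℂ} (hσ : IsUnitalPositive σ) :
    ∃ τ : T.Elt →ₗ[ℂ] ℂ, IsUnitalPositive τ ∧ ∀ a, τ (φ a) = σ a := by
  have hre : ∀ a, realPart (φ a) = φ (realPart a) :=
    realPart_map fun a ha => hφ.isPositive_iff.1 ha
  let A : T.Elt → Set ℝ := fun b => {r | ∃ a, T.IsPositive (realPart (φ a - b)) ∧ (σ a).re = r}
  have hne : ∀ b, (A b).Nonempty := fun b => by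
    obtain ⟨r, hr⟩ := exists_isPositive_smul_unit_sub (adjoint_realPart b)
    refine ⟨_, r • S.unit, ?_, rfl⟩
    have : φ (r • S.unit) = r • T.unit := by
      rw [← Complex.coe_smul, map_smul, hφ.1, Complex.coe_smul]
    rwa [map_sub, this, map_smul, realPart_of_adjoint_eq isPositive_unit.adjoint_eq]
  have hbdd : ∀ b, BddBelow (A b) := fun b => by
    obtain ⟨_, a₀, ha₀, rfl⟩ := hne (-b)
    refine ⟨-(σ a₀).re, ?_⟩
    rintro _ ⟨a, ha, rfl⟩
    have h := ha.add ha₀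
    rw [← map_add, sub_neg_eq_add, sub_add_add_cancel, ← map_add, hre, ← hφ.isPositive_iff] at h
    have h1 := hσ.re_nonneg _ h
    rw [hσ.re_realPart, map_add, Complex.add_re] at h1
    linarith
  let N : T.Elt → ℝ := fun b => sInf (A b)
  have hN : ∀ b a, T.IsPositive (realPart (φ a - b)) → N b ≤ (σ a).re := fun b a h =>
    csInf_le (hbdd b) ⟨a, h, rfl⟩
  have hN' : ∀ b r, (∀ a, T.IsPositive (realPart (φ a - b)) → r ≤ (σ a).re) → r ≤ N b :=
    fun b r H => le_csInf (hne b) (by rintro _ ⟨a, h, rfl⟩; exact H a h)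
  obtain ⟨t, ht, -⟩ := exists_linear_le_eq N (fun c hc b => by
      rw [← inv_mul_le_iff₀ hc]
      refine hN' _ _ fun a ha => ?_
      rw [inv_mul_le_iff₀ hc]
      have h1 := hN (c • b) (c • a) (by
        have : φ (c • a) = c • φ a := by rw [← Complex.coe_smul, map_smul, Complex.coe_smul]
        rw [this, ← smul_sub, map_smul]
        exact ha.smul hc.le)
      rw [← Complex.coe_smul c a, map_smul, smul_eq_mul, Complex.re_ofReal_mul] at h1
      exact h1)
    (fun b b' => by
      rw [← sub_le_iff_le_add]
      refine hN' _ _ fun a ha => ?_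
      rw [sub_le_comm]
      refine hN' _ _ fun a' ha' => ?_
      rw [sub_le_iff_le_add, ← Complex.add_re, ← map_add]
      refine hN _ _ ?_
      have := ha'.add ha
      rw [← map_add] at this
      rw [map_add]
      convert this using 2
      abel) 0
  have htφ : ∀ a, t (φ a) = (σ a).re := fun a => by
    have h1 := (ht (φ a)).trans (hN _ a (by rw [sub_self, map_zero]; exact isPositive_zero))
    have h2 := (ht (-φ a)).trans
      (hN _ (-a) (by rw [map_neg, sub_self, map_zero]; exact isPositive_zero))
    rw [map_neg, map_neg, Complex.neg_re] at h2
    linarith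
  refine ⟨_, isUnitalPositive_extendRCLike (t := t) ?_ fun b hb => ?_, fun a => ?_⟩
  · rw [← hφ.1, htφ, hσ.map_unit, Complex.one_re]
  · have := (ht (-b)).trans (hN _ 0 (by rwa [map_zero, zero_sub, neg_neg]))
    rw [map_neg, map_zero, Complex.zero_re] at this
    linarith
  · refine Complex.ext ?_ ?_
    · exact (Module.Dual.re_extendRCLike_apply (𝕜 := ℂ) t _).trans (htφ a)
    · refine (Module.Dual.im_extendRCLike_apply (𝕜 := ℂ) t _).trans ?_
      change -t (Complex.I • φ a) = _
      rw [← map_smul, htφ, map_smul, smul_eq_mul, Complex.I_mul_re, neg_neg]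

variable {K : Type w} [TopologicalSpace K] [CompactSpace K]

/-- The evaluation at a point, as a functional on an operator system of continuous functions. -/
def pointEval (k : K) : (ofCStarAlgebra C(K, ℂ)).Elt →ₗ[ℂ] ℂ where
  toFun f := f.1 k
  map_add' _ _ := rfl
  map_smul' _ _ := rfl

theorem isUnitalPositive_pointEval (k : K) : IsUnitalPositive (pointEval k) := by
  have h : ∀ f, (ofCStarAlgebra C(K, ℂ)).IsPositive f → ∃ z : ℂ, pointEval k f = star z * z := by
    rintro f ⟨d, hd⟩
    exact ⟨d k, congrArg (fun f : C(K, ℂ) => f k) hd⟩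
  refine ⟨rfl, fun f hf => ?_, fun f hf => ?_⟩ <;> obtain ⟨z, hz⟩ := h f hf <;>
    rw [hz, RCLike.star_def, ← Complex.normSq_eq_conj_mul_self]
  · exact Complex.normSq_nonneg z
  · rfl

/-- For maps into algebras of continuous functions, positivity implies complete positivity. -/
theorem isUCP_of_pointEval {φ : S.Elt →ₗ[ℂ] (ofCStarAlgebra C(K, ℂ)).Elt}
    (hφ : ∀ k, IsUnitalPositive (pointEval k ∘ₗ φ)) : IsUCP φ := by
  refine ⟨Subtype.ext (ContinuousMap.ext fun k => (hφ k).map_unit), fun n M ⟨N, hN⟩ => ?_⟩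
  have hM : ∀ i j, (M i j : S.Ambient) = ∑ l, star (N l i) * N l j := fun i j =>
    (congrFun (congrFun hN i) j).trans (by simp [Matrix.mul_apply])
  refine exists_eq_conjTranspose_mul_self _ ?_ fun k c => ?_
  · ext i j k
    have hadj : M i j = adjoint (M j i) := Subtype.ext (by
      change (M i j : S.Ambient) = star (M j i : S.Ambient)
      simp [hM])
    change star (pointEval k (φ (M j i))) = pointEval k (φ (M i j))
    rw [hadj]
    exact ((hφ k).map_adjoint _).symm
  · have hpos : S.IsPositive (∑ i, ∑ j, (star (c i) * c j) • M i j) := by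
      obtain ⟨b, hb⟩ := exists_sum_eq_star_mul_self Finset.univ fun l => ∑ j, c j • N l j
      refine ⟨b, Eq.trans ?_ hb⟩
      simp only [Submodule.coe_sum, Submodule.coe_smul, hM, star_sum, star_smul,
        Finset.sum_mul_sum, Finset.smul_sum, smul_mul_smul_comm]
      exact (Finset.sum_congr rfl fun i _ => Finset.sum_comm).trans Finset.sum_comm
    have := (hφ k).re_nonneg _ hpos
    simp only [map_sum, map_smul] at this
    exact this

end OperatorSystem

/-! ### Morphisms between systems of continuous functions -/

open OperatorSystem

/-- A real function, as an element of the operator system of complex functions. -/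
def realFun {K : Type w} [TopologicalSpace K] [CompactSpace K] (f : C(K, ℝ)) :
    (ofCStarAlgebra C(K, ℂ)).Elt :=
  ⟨⟨fun k => (f k : ℂ), by fun_prop⟩, Submodule.mem_top⟩

section RealFun

variable {K : Type w} [TopologicalSpace K] [CompactSpace K]

@[simp] theorem realFun_apply (f : C(K, ℝ)) (k : K) : (realFun f).1 k = (f k : ℂ) := rfl

theorem realPart_realFun (f : C(K, ℝ)) : realPart (realFun f) = realFun f :=
  realPart_of_adjoint_eq (Subtype.ext (ContinuousMap.ext fun k => Complex.conj_ofReal (f k)))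

theorem isPositive_realFun {f : C(K, ℝ)} (hf : 0 ≤ f) : IsPositive _ (realFun f) := by
  refine ⟨(realFun ⟨fun k => Real.sqrt (f k), by fun_prop⟩).1, ContinuousMap.ext fun k => ?_⟩
  change (f k : ℂ) = star (Real.sqrt (f k) : ℂ) * (Real.sqrt (f k) : ℂ)
  rw [RCLike.star_def, Complex.conj_ofReal, ← Complex.ofReal_mul,
    Real.mul_self_sqrt (show 0 ≤ f k from hf k)]

theorem eq_realFun_add (b : (ofCStarAlgebra C(K, ℂ)).Elt) :
    b = realFun ⟨fun k => (b.1 k).re, by fun_prop⟩ +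
      Complex.I • realFun ⟨fun k => (b.1 k).im, by fun_prop⟩ :=
  Subtype.ext (ContinuousMap.ext fun k => by
    change b.1 k = ((b.1 k).re : ℂ) + Complex.I * ((b.1 k).im : ℂ)
    rw [mul_comm, Complex.re_add_im])

end RealFun

namespace GMorphism

/-- The composition of morphisms of groupoid dynamical systems. -/
def comp {A B C : GSystem.{w, v, u} 𝒢} (Ψ : GMorphism B C) (Φ : GMorphism A B) :
    GMorphism A C where
  map x := Ψ.map x ∘ₗ Φ.map x
  ucp x := ⟨(congrArg (Ψ.map x) (Φ.ucp x).1).trans (Ψ.ucp x).1, fun n M hM =>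
    (Ψ.ucp x).2 n _ ((Φ.ucp x).2 n M hM)⟩
  equivariant g a := (Ψ.equivariant g _).trans (congrArg _ (Φ.equivariant g a))

variable {Z Y : GSpace.{w, v, u} 𝒢}

/-- The components of a morphism between systems of continuous functions. -/
def fnMap (Φ : GMorphism Z.functionSystem Y.functionSystem) (x : 𝒢) :
    (ofCStarAlgebra C(Z.fibre x, ℂ)).Elt →ₗ[ℂ] (ofCStarAlgebra C(Y.fibre x, ℂ)).Elt := Φ.map x

theorem isUnitalPositive_fnMap (Φ : GMorphism Z.functionSystem Y.functionSystem) {x : 𝒢}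
    (q : Y.fibre x) : IsUnitalPositive (pointEval q ∘ₗ Φ.fnMap x) :=
  (isUnitalPositive_pointEval q).comp (Φ.ucp x)

theorem fnMap_equivariant (Φ : GMorphism Z.functionSystem Y.functionSystem) {x y : 𝒢} (g : x ⟶ y)
    (f : C(Z.fibre y, ℝ)) (q : Y.fibre x) :
    (Φ.fnMap x (realFun (Z.compAct g f))).1 q = (Φ.fnMap y (realFun f)).1 (Y.act g q) := by
  have h1 : mapOfStarAlgEquiv (GSpace.pullback (Z.act g)) (realFun (Z.compAct g f)) = realFun f :=
    Subtype.ext (ContinuousMap.ext fun k => by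
      change ((f (Z.act g ((Z.act g).symm k)) : ℝ) : ℂ) = (f k : ℂ)
      rw [Homeomorph.apply_symm_apply])
  have h2 : mapOfStarAlgEquiv (GSpace.pullback (Y.act g)) (Φ.fnMap x (realFun (Z.compAct g f))) =
      Φ.fnMap y (mapOfStarAlgEquiv (GSpace.pullback (Z.act g)) (realFun (Z.compAct g f))) :=
    Φ.equivariant g (realFun (Z.compAct g f))
  rw [h1] at h2
  rw [← h2]
  change _ = (Φ.fnMap x (realFun (Z.compAct g f))).1 ((Y.act g).symm (Y.act g q))
  rw [Homeomorph.symm_apply_apply]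

/-- The restriction of a morphism of systems of complex functions to the real functions. -/
def toMarkovMap (Φ : GMorphism Z.functionSystem Y.functionSystem) : MarkovMap Z Y where
  map x :=
    { toFun := fun f => ⟨fun q => ((Φ.fnMap x (realFun f)).1 q).re, by fun_prop⟩
      map_add' := fun f f' => ContinuousMap.ext fun q => by
        have : realFun (f + f') = realFun f + realFun f' :=
          Subtype.ext (ContinuousMap.ext fun k => Complex.ofReal_add _ _)
        change ((Φ.fnMap x (realFun (f + f'))).1 q).re = _
        rw [this, map_add]
        rfl
      map_smul' := fun c f => ContinuousMap.ext fun q => by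
        have : realFun (c • f) = (c : ℂ) • realFun f :=
          Subtype.ext (ContinuousMap.ext fun k => Complex.ofReal_mul _ _)
        change ((Φ.fnMap x (realFun (c • f))).1 q).re = _
        rw [this, map_smul]
        exact Complex.re_ofReal_mul _ _ }
  nonneg x f hf q := by
    have := (Φ.isUnitalPositive_fnMap q).re_nonneg _ (isPositive_realFun hf)
    exact this
  map_one x := ContinuousMap.ext fun q => by
    have : realFun (1 : C(Z.fibre x, ℝ)) = unit _ :=
      Subtype.ext (ContinuousMap.ext fun k => Complex.ofReal_one)
    change ((Φ.fnMap x (realFun 1)).1 q).re = 1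
    rw [this]
    exact congrArg Complex.re (Φ.isUnitalPositive_fnMap q).map_unit
  equivariant {x y} g f := ContinuousMap.ext fun q =>
    congrArg Complex.re (Φ.fnMap_equivariant g f q)

theorem fnMap_realFun (Φ : GMorphism Z.functionSystem Y.functionSystem) (x : 𝒢)
    (f : C(Z.fibre x, ℝ)) : Φ.fnMap x (realFun f) = realFun (Φ.toMarkovMap.map x f) :=
  Subtype.ext (ContinuousMap.ext fun q => by
    have h := (Φ.isUnitalPositive_fnMap q).im_realPart (realFun f)
    rw [realPart_realFun] at h
    exact Complex.ext (show ((Φ.fnMap x (realFun f)).1 q).re = _ from rfl)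
      (show ((Φ.fnMap x (realFun f)).1 q).im = 0 from h))

end GMorphism

namespace GSpace

/-- The embedding of the scalars as constant functions on a space. -/
def constMap (K : Type w) [TopologicalSpace K] [CompactSpace K] :
    (ofCStarAlgebra (ULift.{w} ℂ)).Elt →ₗ[ℂ] (ofCStarAlgebra C(K, ℂ)).Elt where
  toFun z := ⟨ContinuousMap.const _ z.1.down, Submodule.mem_top⟩
  map_add' _ _ := rfl
  map_smul' _ _ := rfl

theorem isCompleteOrderEmbedding_constMap (K : Type w) [TopologicalSpace K] [CompactSpace K]
    [Nonempty K] : IsCompleteOrderEmbedding (constMap K) := by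
  refine ⟨rfl, fun n M => ⟨fun ⟨N, hN⟩ => ?_, fun ⟨N, hN⟩ => ?_⟩⟩
  · refine ⟨N.map fun z => ContinuousMap.const _ z.down, ?_⟩
    ext i j k
    have h := congrArg (ULift.ringEquiv (R := ℂ)) (congrFun (congrFun hN i) j)
    rw [Matrix.mul_apply, map_sum] at h
    rw [Matrix.mul_apply, ContinuousMap.sum_apply]
    exact h
  · obtain ⟨k⟩ := ‹Nonempty K›
    refine ⟨N.map fun f => ⟨f k⟩, Matrix.ext fun i j => ?_⟩
    have h := congrArg (ContinuousMap.evalAlgHom ℂ ℂ k) (congrFun (congrFun hN i) j)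
    rw [Matrix.mul_apply, map_sum] at h
    refine (ULift.ringEquiv (R := ℂ)).injective ?_
    rw [Matrix.mul_apply, map_sum]
    exact h

/-- The embedding of the trivial system as the constant functions. -/
def constMorphism (X : GSpace.{w, v, u} 𝒢) : GMorphism (trivialSystem.{w} 𝒢) X.functionSystem where
  map x := constMap (X.fibre x)
  ucp x := (isCompleteOrderEmbedding_constMap (X.fibre x)).isUCP
  equivariant _ _ := rfl

theorem isEmbedding_constMorphism (X : GSpace.{w, v, u} 𝒢) : X.constMorphism.IsEmbedding :=
  fun x => isCompleteOrderEmbedding_constMap (X.fibre x)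

/-- Every extension by the functions on a boundary is rigid, as the only endomorphism of this
system is the identity. -/
theorem IsBoundary.isRigid {X : GSpace.{w, v, u} 𝒢} (hX : X.IsBoundary)
    {A : GSystem.{w, v, u} 𝒢} (Θ : GMorphism A X.functionSystem) : Θ.IsRigid := by
  intro Φ _ x (b : (ofCStarAlgebra C(X.fibre x, ℂ)).Elt)
  have h : ∀ f, Φ.fnMap x (realFun f) = realFun f := fun f => by
    rw [Φ.fnMap_realFun, hX.markovMap_eq]
  change Φ.fnMap x b = b
  rw [eq_realFun_add b, map_add, map_smul, h, h]

end GSpace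

/-! ### The Poisson transform -/

theorem OperatorSystem.exists_forall_abs_re_le {S : OperatorSystem.{w}} (a : S.Elt) :
    ∃ C, ∀ σ : S.Elt →ₗ[ℂ] ℂ, IsUnitalPositive σ → |(σ a).re| ≤ C := by
  have h : ∀ a : S.Elt, ∃ C, ∀ σ : S.Elt →ₗ[ℂ] ℂ, IsUnitalPositive σ → (σ a).re ≤ C := fun a => by
    obtain ⟨r, hr⟩ := exists_isPositive_smul_unit_sub (adjoint_realPart a)
    refine ⟨r, fun σ hσ => ?_⟩
    have h1 := hσ.re_nonneg _ hr
    rw [map_sub, ← Complex.coe_smul, map_smul, hσ.map_unit, Complex.sub_re, hσ.re_realPart] at h1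
    simpa using h1
  obtain ⟨C, hC⟩ := h a
  obtain ⟨C', hC'⟩ := h (-a)
  refine ⟨max C C', fun σ hσ => abs_le.2 ⟨?_, (hC σ hσ).trans (le_max_left _ _)⟩⟩
  have h1 := (hC' σ hσ).trans (le_max_right C C')
  rw [map_neg, Complex.neg_re] at h1
  linarith

namespace GSystem

variable {B : GSystem.{max u v w, v, u} 𝒢}
  {τ : ∀ x, (B.fibre x).Elt →ₗ[ℂ] ℂ} (hτ : ∀ x, IsUnitalPositive (τ x))

theorem isUnitalPositive_comp_act (hτ : ∀ x, IsUnitalPositive (τ x)) {x y : 𝒢} (g : x ⟶ y) :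
    IsUnitalPositive (τ y ∘ₗ B.act g) :=
  (hτ y).comp (B.act_iso g).2.isUCP

/-- The Poisson transform of `b` with respect to a family of states `τ`: the bounded function
`h ↦ Re τ(h⁻¹ b)` on the set of arrows with the range that `b` belongs to. -/
def poisson (hτ : ∀ x, IsUnitalPositive (τ x)) (y : 𝒢) :
    (B.fibre y).Elt →ₗ[ℝ] ArrowFun.{w} y where
  toFun b := BoundedContinuousFunction.ofNormedAddCommGroupDiscrete
    (fun h : ArrowsInto.{w} y => (τ h.source (B.act (Groupoid.inv h.hom) b)).re)
    (exists_forall_abs_re_le b).choose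
    fun h => (exists_forall_abs_re_le b).choose_spec _ (isUnitalPositive_comp_act hτ _)
  map_add' b b' := by
    ext h
    change (τ h.source (B.act (Groupoid.inv h.hom) (b + b'))).re = _
    rw [map_add, map_add]
    rfl
  map_smul' c b := by
    ext h
    change (τ h.source (B.act (Groupoid.inv h.hom) (c • b))).re = _
    rw [← Complex.coe_smul, map_smul, map_smul]
    exact Complex.re_ofReal_mul _ _

theorem poisson_apply (hτ : ∀ x, IsUnitalPositive (τ x)) (y : 𝒢) (b : (B.fibre y).Elt)
    (h : ArrowsInto.{w} y) :
    poisson hτ y b h = (τ h.source (B.act (Groupoid.inv h.hom) b)).re := rfl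

theorem shift_poisson {x y : 𝒢} (g : x ⟶ y) (b : (B.fibre x).Elt) :
    ArrowFun.shift g (poisson hτ y (B.act g b)) = poisson hτ x b := by
  ext h
  change (τ h.source (B.act (Groupoid.inv (h.hom ≫ g)) (B.act g b))).re = _
  rw [← B.act_mul]
  have : g ≫ Groupoid.inv (h.hom ≫ g) = Groupoid.inv h.hom := by
    simp [Groupoid.inv_eq_inv]
  rw [this]
  rfl

theorem poisson_unit (y : 𝒢) : poisson hτ y (B.fibre y).unit = 1 := by
  ext h
  have := (isUnitalPositive_comp_act hτ (Groupoid.inv h.hom)).map_unit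
  exact congrArg Complex.re this

theorem poisson_nonneg (y : 𝒢) (b : (B.fibre y).Elt) (hb : IsPositive _ (realPart b))
    (h : ArrowsInto.{w} y) : 0 ≤ poisson hτ y b h := by
  have h1 := isUnitalPositive_comp_act hτ (Groupoid.inv h.hom)
  have h2 := h1.re_nonneg _ hb
  rwa [h1.re_realPart] at h2

end GSystem

namespace IsInvariantSublinear

variable {p : ∀ y : 𝒢, ArrowFun.{w} y → ℝ} (hp : IsInvariantSublinear p)
  {B : GSystem.{max u v w, v, u} 𝒢} {τ : ∀ x, (B.fibre x).Elt →ₗ[ℂ] ℂ}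
  (hτ : ∀ x, IsUnitalPositive (τ x))

/-- The real functional `b ↦ k (poisson b)` for a point `k` of `extremeSpace`. -/
def poissonAt {y : 𝒢} (k : hp.extremeSpace.fibre y) : (B.fibre y).Elt →ₗ[ℝ] ℝ :=
  linearMapOfMem (hp.mem_dominated_of_fibre k) ∘ₗ GSystem.poisson hτ y

theorem poissonAt_apply {y : 𝒢} (k : hp.extremeSpace.fibre y) (b : (B.fibre y).Elt) :
    hp.poissonAt hτ k b = k.1 (GSystem.poisson hτ y b) := rfl

theorem isUnitalPositive_poissonAt {y : 𝒢} (k : hp.extremeSpace.fibre y) :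
    IsUnitalPositive (Module.Dual.extendRCLike (𝕜 := ℂ) (hp.poissonAt hτ k)) := by
  refine isUnitalPositive_extendRCLike ?_ fun b hb => ?_
  · rw [poissonAt_apply, GSystem.poisson_unit, apply_one]
  · have h1 := hp.apply_le_of_forall_le k (GSystem.poisson hτ y (-b)) (C := 0) fun h => by
      rw [map_neg, BoundedContinuousFunction.neg_apply]
      exact neg_nonpos.2 (GSystem.poisson_nonneg hτ y b hb h)
    rw [← poissonAt_apply hp hτ, map_neg] at h1
    linarith

/-- The map into the functions on a fibre of `extremeSpace` given by the Poisson transform. -/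
def poissonMap (y : 𝒢) :
    (B.fibre y).Elt →ₗ[ℂ] (ofCStarAlgebra C(hp.extremeSpace.fibre y, ℂ)).Elt where
  toFun b := ⟨⟨fun k => Module.Dual.extendRCLike (𝕜 := ℂ) (hp.poissonAt hτ k) b, by
    change Continuous fun k =>
      ((hp.coord (ContinuousMap.id _) (GSystem.poisson hτ y b) k : ℝ) : ℂ) - Complex.I *
        ((hp.coord (ContinuousMap.id _) (GSystem.poisson hτ y (Complex.I • b)) k : ℝ) : ℂ)
    fun_prop⟩, Submodule.mem_top⟩
  map_add' b b' := Subtype.ext (ContinuousMap.ext fun k =>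
    map_add (Module.Dual.extendRCLike (𝕜 := ℂ) (hp.poissonAt hτ k)) b b')
  map_smul' c b := Subtype.ext (ContinuousMap.ext fun k =>
    map_smul (Module.Dual.extendRCLike (𝕜 := ℂ) (hp.poissonAt hτ k)) c b)

/-- The morphism into the system of functions on `extremeSpace` given by the Poisson transform. -/
def poissonMorphism : GMorphism B hp.extremeSpace.functionSystem where
  map y := hp.poissonMap hτ y
  ucp y := isUCP_of_pointEval fun k => hp.isUnitalPositive_poissonAt hτ k
  equivariant {x y} g b := Subtype.ext (ContinuousMap.ext fun k => by
    obtain ⟨k, rfl⟩ := (hp.extremeSpace.act g).surjective k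
    have h : ∀ b, hp.poissonAt hτ (hp.extremeSpace.act g k) (B.act g b) = hp.poissonAt hτ k b :=
      fun b => congrArg k.1 (GSystem.shift_poisson hτ g b)
    change Module.Dual.extendRCLike (𝕜 := ℂ) (hp.poissonAt hτ
      ((hp.extremeSpace.act g).symm (hp.extremeSpace.act g k))) b =
        Module.Dual.extendRCLike (𝕜 := ℂ) (hp.poissonAt hτ (hp.extremeSpace.act g k)) (B.act g b)
    rw [Homeomorph.symm_apply_apply, Module.Dual.extendRCLike_apply,
      Module.Dual.extendRCLike_apply, h, ← map_smul (B.act g), h])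

end IsInvariantSublinear

/-! ### Injectivity, and comparison of the boundaries -/

open OperatorSystem

namespace IsInvariantSublinear

variable {p : ∀ y : 𝒢, ArrowFun.{w} y → ℝ} (hp : IsInvariantSublinear p)

/-- The bounded function `h ↦ f (h x₀)` on the set of arrows into `y`, for a function `f` on the
fibre over `y` and a family `x₀` of base points. -/
def orbitFun (x₀ : ∀ x, hp.extremeSpace.fibre x) (y : 𝒢) :
    C(hp.extremeSpace.fibre y, ℝ) →ₗ[ℝ] ArrowFun.{w} y where
  toFun f := BoundedContinuousFunction.ofNormedAddCommGroupDiscrete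
    (fun h : ArrowsInto.{w} y => f (hp.extremeSpace.act h.hom (x₀ h.source))) ‖f‖
    fun _ => f.norm_coe_le_norm _
  map_add' _ _ := rfl
  map_smul' _ _ := rfl

/-- The Markov map that restricts a function to the orbits of base points and evaluates the result
at the points of `extremeSpace`. -/
def orbitMarkovMap (x₀ : ∀ x, hp.extremeSpace.fibre x) :
    MarkovMap hp.extremeSpace hp.extremeSpace where
  map y := hp.coord (ContinuousMap.id _) ∘ₗ hp.orbitFun x₀ y
  nonneg y f hf k := by
    have h1 := hp.apply_le_of_forall_le k (hp.orbitFun x₀ y (-f)) (C := 0) fun h =>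
      neg_nonpos.2 (hf _)
    have h2 : k.1 (-hp.orbitFun x₀ y f) = -k.1 (hp.orbitFun x₀ y f) :=
      (linearMapOfMem (hp.mem_dominated_of_fibre k)).map_neg _
    rw [map_neg, h2] at h1
    exact neg_nonpos.1 h1
  map_one y := ContinuousMap.ext fun k => hp.apply_one k
  equivariant {x y} g f := ContinuousMap.ext fun k => by
    change k.1 (hp.orbitFun x₀ x (hp.extremeSpace.compAct g f)) =
      k.1 (ArrowFun.shift g (hp.orbitFun x₀ y f))
    refine congrArg k.1 (BoundedContinuousFunction.ext fun h => ?_)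
    exact congrArg f (hp.extremeSpace.act_mul h.hom g _).symm

/-- If `extremeSpace` is a boundary, then its system of functions is injective. A morphism `Ψ` into
this system is determined by the states `ev ∘ Ψ` at base points, as it is their Poisson transform,
by rigidity; an extension of `Ψ` is the Poisson transform of extensions of these states. -/
theorem isInjective_extremeSpace (hb : hp.extremeSpace.IsBoundary) :
    hp.extremeSpace.functionSystem.IsInjective := by
  intro A B Φ Ψ hΦ
  have x₀ : ∀ x, hp.extremeSpace.fibre x := fun x => Classical.choice (hp.extremeSpace.nonempty x)
  let c : ∀ y, (A.fibre y).Elt →ₗ[ℂ] (ofCStarAlgebra C(hp.extremeSpace.fibre y, ℂ)).Elt := Ψ.map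
  have hσ : ∀ x, IsUnitalPositive (pointEval (x₀ x) ∘ₗ c x) := fun x =>
    (isUnitalPositive_pointEval (x₀ x)).comp (Ψ.ucp x)
  choose τ hτ hτΦ using fun x => (hσ x).exists_extension (hΦ x)
  refine ⟨hp.poissonMorphism hτ, fun y a => Subtype.ext (ContinuousMap.ext fun k => ?_)⟩
  have hc : ∀ (a : (A.fibre y).Elt), hp.poissonAt hτ k (Φ.map y a) = ((c y a).1 k).re := fun a => by
    let f : C(hp.extremeSpace.fibre y, ℝ) := ⟨fun k => ((c y a).1 k).re, by fun_prop⟩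
    have h1 : GSystem.poisson hτ y (Φ.map y a) = hp.orbitFun x₀ y f := by
      ext h
      have h2 : mapOfStarAlgEquiv (GSpace.pullback (hp.extremeSpace.act (Groupoid.inv h.hom)))
          (c y a) = c h.source (A.act (Groupoid.inv h.hom) a) := Ψ.equivariant _ a
      rw [GSystem.poisson_apply, Φ.equivariant, hτΦ, LinearMap.comp_apply, ← h2]
      change ((c y a).1 ((hp.extremeSpace.act (Groupoid.inv h.hom)).symm (x₀ h.source))).re = _
      rw [(Homeomorph.symm_apply_eq _).2 (hp.extremeSpace.act_inv_act h.hom (x₀ h.source)).symm]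
      rfl
    have h2 := DFunLike.congr_fun (hb.markovMap_eq (hp.orbitMarkovMap x₀) y f) k
    rw [poissonAt_apply, h1]
    exact h2
  change Module.Dual.extendRCLike (𝕜 := ℂ) (hp.poissonAt hτ k) (Φ.map y a) = (c y a).1 k
  refine Complex.ext ?_ ?_
  · exact (Module.Dual.re_extendRCLike_apply (𝕜 := ℂ) (hp.poissonAt hτ k) _).trans (hc a)
  · refine (Module.Dual.im_extendRCLike_apply (𝕜 := ℂ) (hp.poissonAt hτ k) _).trans ?_
    change -hp.poissonAt hτ k (Complex.I • Φ.map y a) = _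
    rw [← map_smul, hc, map_smul]
    change -(Complex.I * (c y a).1 k).re = _
    rw [Complex.I_mul_re, neg_neg]

end IsInvariantSublinear

namespace GSpace

/-- Every groupoid has a boundary whose system of continuous functions is injective. -/
theorem exists_isBoundary_isInjective (𝒢 : Type u) [Groupoid.{v} 𝒢] :
    ∃ X : GSpace.{max u v w} 𝒢, X.IsBoundary ∧ X.functionSystem.IsInjective := by
  obtain ⟨p, hp, hmin⟩ := IsInvariantSublinear.exists_minimal.{w} (𝒢 := 𝒢)
  have hb := IsInvariantSublinear.isBoundary_extremeSpace (hp := hp) hmin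
  exact ⟨hp.extremeSpace, hb, hp.isInjective_extremeSpace hb⟩

variable {X Y : GSpace.{w, v, u} 𝒢}

theorem IsBoundary.isHamanaBoundary (hX : X.IsBoundary) (hinj : X.functionSystem.IsInjective) :
    X.IsHamanaBoundary :=
  ⟨X.constMorphism, X.isEmbedding_constMorphism, hinj, hX.isRigid _⟩

theorem IsBoundary.isFurstenbergBoundary (hX : X.IsBoundary)
    (hinj : X.functionSystem.IsInjective) : X.IsFurstenbergBoundary := by
  refine ⟨hX, fun Z hZ => ?_⟩
  obtain ⟨Φ, -⟩ := hinj _ _ Z.constMorphism X.constMorphism Z.isEmbedding_constMorphism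
  exact hZ.hasQuotient hX.1 Φ.toMarkovMap

/-- Injectivity gives morphisms in both directions between the systems of functions on `X` and `Y`,
and `C(Y) → C(X) → C(Y)` is the identity by rigidity. Hence the points of `Y` to which the second
map assigns point masses exhaust `Y`, and this map is the composition with a homeomorphism. -/
theorem IsBoundary.isomorphic_of_isHamanaBoundary (hX : X.IsBoundary)
    (hinj : X.functionSystem.IsInjective) (hY : Y.IsHamanaBoundary) : Y.Isomorphic X := by
  obtain ⟨Θ, hΘ, hYinj, hrigid⟩ := hY
  obtain ⟨hXm, hXp⟩ := isBoundary_iff.1 hX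
  obtain ⟨α, hα⟩ := hinj _ _ Θ X.constMorphism hΘ
  obtain ⟨β, hβ⟩ := hYinj _ _ X.constMorphism Θ X.isEmbedding_constMorphism
  have hid := hrigid (β.comp α) fun x a => (congrArg (β.map x) (hα x a)).trans (hβ x a)
  have hβα : ∀ x f, β.toMarkovMap.map x (α.toMarkovMap.map x f) = f := fun x f => by
    have h1 : β.fnMap x (α.fnMap x (realFun f)) = realFun f := hid x (realFun f)
    rw [α.fnMap_realFun, β.fnMap_realFun] at h1
    exact ContinuousMap.ext fun q =>
      Complex.ofReal_injective (congrArg (fun a => pointEval q a) h1)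
  have hdirac : ∀ (x : 𝒢) (q : Y.fibre x), ∃ p, β.toMarkovMap.IsDiracAt q p := by
    intro x q₀
    by_contra hq₀
    obtain ⟨f, hf0, hf1, hf⟩ := exists_continuous_zero_one_of_isClosed
      (β.toMarkovMap.isClosed_setOf_exists_isDiracAt x) (isClosed_singleton (x := q₀))
      (Set.disjoint_singleton_right.2 hq₀)
    -- `f` vanishes where `β` assigns point masses, which reach all points of `X`; so `α f = 0`.
    have hαf : α.toMarkovMap.map x f = 0 := ContinuousMap.ext fun p => by
      obtain ⟨q, hq⟩ := β.toMarkovMap.exists_isDiracAt_right hXp hXm p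
      rw [← hq, hβα]
      exact hf0 ⟨p, hq⟩
    have h0 := hβα x f
    rw [hαf, map_zero] at h0
    have h1 : f q₀ = 1 := hf1 rfl
    rw [← h0] at h1
    exact zero_ne_one h1
  obtain ⟨r, hr, hr', hd⟩ := β.toMarkovMap.exists_quotient hXp hXm hdirac
  refine isomorphic_of_bijective r (fun x => ⟨fun q q' hqq' => ?_, hr x⟩) hr'
  refine eq_of_forall_apply_eq fun f => ?_
  rw [← hβα x f, hd x q, hd x q', hqq']

end GSpace

end

theorem mainTheorem1 {𝒢 : Type u} [Groupoid.{v} 𝒢] :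
    (∃ X : GSpace.{max u v w} 𝒢, X.IsFurstenbergBoundary) ∧
    (∃ Y : GSpace.{max u v w} 𝒢, Y.IsHamanaBoundary) ∧
    ∀ X Y : GSpace.{max u v w} 𝒢, X.IsFurstenbergBoundary → Y.IsHamanaBoundary →
      X.Isomorphic Y := by
  obtain ⟨B, hB, hinj⟩ := GSpace.exists_isBoundary_isInjective.{w} 𝒢
  have hF := hB.isFurstenbergBoundary hinj
  exact ⟨⟨B, hF⟩, ⟨B, hB.isHamanaBoundary hinj⟩, fun X Y hX hY =>
    (hX.isomorphic hF).trans (hB.isomorphic_of_isHamanaBoundary hinj hY).symm⟩
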